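/- Let $\sigma\ge 1/2$, $\beta>0$, $\lambda>0$. For $t>0$ let $\mathcal I(t)=\int_0^\infty \frac{t^{\tau-1}}{\Gamma(\tau)}\,d\tau$ be the Volterra function of order $-1$, and let $$(U_0(t)\psi)(\mathbf x)=\frac1{2\pi}\int_{\mathbb R^2}\frac{e^{-|\mathbf x-\mathbf y|^2/(4it)}}{2it}\,\psi(\mathbf y)\,d\mathbf y$$ be the free Schrödinger evolution. Let $G_\lambda(\mathbf x)=\frac1{2\pi}K_0(\sqrt\lambda\,|\mathbf x|)$ be the Green function of $-\Delta+\lambda$ on $\mathbb R^2$, with $K_0$ the MacDonald function of order zero. Let the initial datum be $\psi_0=\phi_{\lambda,0}+q_0G_\lambda$ with $\phi_{\lambda,0}\in\mathcal S(\mathbb R^2)$ a Schwartz function and $q_0\in\mathbb C$. Let $q\colon[0,T_*)\to\mathbb C$ be the continuous solution of the charge equation $$q(t)+\int_0^t\Big(-4\pi\beta\,\mathcal I(t-\tau)|q(\tau)|^{2\sigma}q(\tau)+\kappa\,\mathcal I(t-\tau)\,q(\tau)\Big)d\tau=4\pi\int_0^t\mathcal I(t-\tau)\,(U_0(\tau)\psi_0)(\mathbf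 0)\,d\tau,\qquad 0<t<T_*,$$ where $\kappa=-2\big(\log 2-\gamma+i\tfrac{\pi}{4}\big)$, $\gamma$ is the Euler–Mascheroni constant, and $T_*\in(0,\infty]$ is the maximal existence time, i.e. $q$ does not extend to a continuous solution on $[0,S)$ for any $S>T_*$. Then $q\in W^{1,1}(0,T)$ for every $0<T<T_*$, that is, $q$ is integrable on $(0,T)$ and has an integrable weak derivative there. -/

import Mathlib

open MeasureTheory Set
open scoped ContDiff SchwartzMap

noncomputable section

namespace PointNLS

/-- The Euclidean plane. -/
abbrev Plane : Type := EuclideanSpace ℝ (Fin 2)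

/-- The Volterra function of order `-1`: `𝓘(t) = ∫₀^∞ t^(τ-1) / Γ(τ) dτ` (convergent for `t > 0`;
the value at `t = 0` is never used, since `𝓘` only occurs under integrals). -/
def volterra (t : ℝ) : ℝ :=
  ∫ τ in Ioi (0 : ℝ), t ^ (τ - 1) / Real.Gamma τ

/-- The MacDonald function of order zero, `K₀(r) = ∫₀^∞ exp (-r cosh s) ds` for `r > 0`. -/
def macdonaldZero (r : ℝ) : ℝ :=
  ∫ s in Ioi (0 : ℝ), Real.exp (-(r * Real.cosh s))

/-- The Green function `G_lam(x) = (1 / 2π) K₀(√lam |x|)` of `-Δ + lam` on the plane (`lam > 0`). -/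
def green (lam : ℝ) (x : Plane) : ℝ :=
  1 / (2 * Real.pi) * macdonaldZero (Real.sqrt lam * ‖x‖)

/-- The initial data with Schwartz regular part: functions `ψ = φ + q₀ G_lam` (almost everywhere)
with `φ` a Schwartz function and `q₀` a complex number. The requirements that `ψ` be square
integrable, that `φ` lie in `H¹` and that `(1 + |k|^ε) φ̂(k)` be integrable for some `ε > 0` are
automatic for Schwartz `φ`. -/
def schwartzData (lam : ℝ) : Set (Plane → ℂ) :=
  {ψ | ∃ (φ : 𝓢(Plane, ℂ)) (q₀ : ℂ), ∀ᵐ x : Plane, ψ x = φ x + q₀ * (green lam x : ℂ)}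

/-- The kernel of the free Schrödinger propagator, `U₀(t; r) = exp (-r² / (4 i t)) / (2 i t)`. -/
def freeKernel (t r : ℝ) : ℂ :=
  Complex.exp (-((r : ℂ) ^ 2 / (4 * Complex.I * (t : ℂ)))) / (2 * Complex.I * (t : ℂ))

/-- The free evolution `(U₀(t) ψ)(x) = (1 / 2π) ∫ U₀(t; |x - y|) ψ(y) dy` for `t > 0`. The integral
converges absolutely for integrable `ψ`, in particular for the data in `schwartzData`. -/
def freeEvolution (t : ℝ) (ψ : Plane → ℂ) (x : Plane) : ℂ :=
  1 / (2 * (Real.pi : ℂ)) * ∫ y : Plane, freeKernel t ‖x - y‖ * ψ y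

/-- The constant `κ = -2 (log 2 - γ + i π / 4)`, with `γ` the Euler-Mascheroni constant. -/
def kappa : ℂ :=
  -2 * ((Real.log 2 : ℂ) - (Real.eulerMascheroniConstant : ℂ)
    + Complex.I * ((Real.pi : ℂ) / 4))

/-- The nonlinear kernel `g(t, τ, z) = -4 π β 𝓘(t - τ) |z|^(2σ) z`. -/
def nonlinearKernel (σ β t τ : ℝ) (z : ℂ) : ℂ :=
  -4 * (Real.pi : ℂ) * (β : ℂ) * (volterra (t - τ) : ℂ) * ((‖z‖ ^ (2 * σ) : ℝ) : ℂ) * z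

/-- The forcing term `f(t) = 4 π ∫₀ᵗ 𝓘(t - τ) (U₀(τ) ψ₀)(0) dτ`. -/
def forcing (ψ₀ : Plane → ℂ) (t : ℝ) : ℂ :=
  4 * (Real.pi : ℂ) * ∫ τ in (0 : ℝ)..t, (volterra (t - τ) : ℂ) * freeEvolution τ ψ₀ 0

/-- `q` is a (continuous) solution on `[0, S)`, `S ∈ (0, ∞]`, of the charge equation
`q(t) + ∫₀ᵗ (g(t, τ, q(τ)) + κ 𝓘(t - τ) q(τ)) dτ = f(t)`. The equation is imposed for `t > 0`; its
meaning at `t = 0` is the limit `t → 0⁺`, which continuity of `q` takes care of (the forcing term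
tends to the charge of the initial datum, while a literal integral over `[0, 0]` would be zero). -/
structure IsChargeSolution (σ β : ℝ) (ψ₀ : Plane → ℂ) (S : EReal) (q : ℝ → ℂ) : Prop where
  pos : 0 < S
  continuousOn : ContinuousOn q {t : ℝ | 0 ≤ t ∧ (t : EReal) < S}
  equation : ∀ t : ℝ, 0 < t → (t : EReal) < S →
    q t + (∫ τ in (0 : ℝ)..t,
      (nonlinearKernel σ β t τ (q τ) + kappa * (volterra (t - τ) : ℂ) * q τ)) = forcing ψ₀ t

/-- `q` solves the charge equation on `[0, Tstar)`, and `Tstar ∈ (0, ∞]` is its maximal existence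
time: `q` has no extension to a solution on a longer interval. -/
structure IsMaximalChargeSolution (σ β : ℝ) (ψ₀ : Plane → ℂ) (Tstar : EReal) (q : ℝ → ℂ) :
    Prop where
  isSolution : IsChargeSolution σ β ψ₀ Tstar q
  maximal : ∀ (S : EReal) (p : ℝ → ℂ), IsChargeSolution σ β ψ₀ S p →
    (∀ t : ℝ, 0 ≤ t → (t : EReal) < Tstar → p t = q t) → S ≤ Tstar

/-- The Sobolev space `W^{1,1}(a, b)` of complex-valued functions: `u` is integrable on `(a, b)`
and has an integrable weak derivative `v` there. -/
def MemW11 (a b : ℝ) (u : ℝ → ℂ) : Prop :=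
  IntegrableOn u (Ioo a b) ∧ ∃ v : ℝ → ℂ, IntegrableOn v (Ioo a b) ∧
    ∀ η : ℝ → ℝ, ContDiff ℝ ∞ η → HasCompactSupport η → tsupport η ⊆ Ioo a b →
      (∫ t in Ioo a b, ((deriv η t : ℝ) : ℂ) * u t) = -(∫ t in Ioo a b, ((η t : ℝ) : ℂ) * v t)

end PointNLS

end

/-!
The charge equation is a nonlinear Volterra equation of the second kind, and the proof shows that
its solution has the regularity of its source, once the logarithmic singularity of the source has
been integrated against the kernel.

**The source.** Writing the Green function as a superposition of heat kernels gives
`4π (U₀(t) G_lam)(0) = ∫₀^∞ e^{-lam s} / (s + i t) ds`. This function `F` satisfies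
`F' = i lam F - 1 / t` and is `O(t^{-1/2})`, so `F + log t` has an integrable derivative near `0`
(`exists_greenTrace_add_log`). The Schwartz part contributes a Lipschitz function of `t`, by the
frequency-side formula `freeEvolution_schwartz`. Hence the source is `R(t) - q₀ (log t + γ)`, where
the increments of `R` are dominated by those of a monotone function
(`exists_freeEvolution_decomposition`).

**The logarithm.** With `ρ_a(t) = t^(a-1) / Γ(a)` one has `𝓘 = ∫₀^∞ ρ_a da`, and the semigroup law
`ρ_a * ρ_b = ρ_{a+b}` gives `𝓘 * ρ_b = ∫_b^∞ ρ_a da`. Differentiating at `b = 1` yields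
`𝓘 * (log + γ) = -1` (`integral_volterra_mul_log`). The equation becomes
`q = q₀ + 𝓘 * (R - Φ(q))` with `Φ` locally Lipschitz (`charge_eq_add_integral`).

**Translation estimate.** Call `u` translation-Lipschitz if `‖u(· + δ) - u‖₁ ≤ C δ` for small `δ`.
Both `R` and, by an absorption argument in an exponentially weighted `L¹` norm, `R - Φ(q)` have this
property (`translationLipschitz_of_volterra`).

**From translations to a weak derivative.** A translation-Lipschitz function need not have an
integrable derivative, but its convolution with an integrable kernel does: for test functions `w`
one has `‖w' * u‖₁ ≤ C ‖w‖₁`, so `w ↦ w' * u` extends continuously from test functions to all of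
`L¹` (`exists_weakDeriv_convolution`). Applied to the kernel `𝓘` on `(0, T)` this is the theorem.
-/

open Filter Topology ENNReal
open scoped Convolution FourierTransform

namespace PointNLS

/-! ### Power kernels and the Volterra function -/

/-- The Riemann–Liouville kernel `ρ_a(t) = t^(a-1) / Γ(a)`, so that `𝓘(t) = ∫₀^∞ ρ_a(t) da`. -/
noncomputable def powerKernel (a t : ℝ) : ℝ := t ^ (a - 1) / Real.Gamma a

lemma volterra_eq (t : ℝ) : volterra t = ∫ a in Ioi (0 : ℝ), powerKernel a t := rfl

lemma powerKernel_pos {a t : ℝ} (ha : 0 < a) (ht : 0 < t) : 0 < powerKernel a t :=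
  div_pos (Real.rpow_pos_of_pos ht _) (Real.Gamma_pos_of_pos ha)

lemma continuous_inv_Gamma : Continuous fun a : ℝ => (Real.Gamma a)⁻¹ := by
  have h : Continuous fun a : ℝ => ((Complex.Gamma a)⁻¹).re :=
    Complex.continuous_re.comp
      (Complex.differentiable_one_div_Gamma.continuous.comp Complex.continuous_ofReal)
  refine h.congr fun a => ?_
  rw [Complex.Gamma_ofReal, ← Complex.ofReal_inv, Complex.ofReal_re]

lemma measurable_powerKernel : Measurable fun p : ℝ × ℝ => powerKernel p.1 p.2 := by
  unfold powerKernel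
  simp only [div_eq_mul_inv]
  exact (measurable_snd.pow (measurable_fst.sub_const 1)).mul
    (continuous_inv_Gamma.measurable.comp measurable_fst)

lemma continuous_powerKernel {t : ℝ} (ht : 0 < t) : Continuous fun a => powerKernel a t := by
  unfold powerKernel
  simp only [div_eq_mul_inv]
  exact (Real.continuous_const_rpow ht.ne').comp (continuous_id.sub continuous_const) |>.mul
    continuous_inv_Gamma

/-- The lower bound `Γ(a) ≥ e^{-c} c^{a-1}`, obtained by discarding `u < c` in Euler's integral. -/
lemma exp_neg_mul_rpow_le_Gamma {a c : ℝ} (ha : 1 ≤ a) (hc : 0 < c) :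
    Real.exp (-c) * c ^ (a - 1) ≤ Real.Gamma a := by
  rw [Real.Gamma_eq_integral (by linarith)]
  have hint := Real.GammaIntegral_convergent (s := a) (by linarith)
  calc Real.exp (-c) * c ^ (a - 1) = ∫ u in Ioi c, Real.exp (-u) * c ^ (a - 1) := by
        rw [integral_mul_const, integral_exp_neg_Ioi]
    _ ≤ ∫ u in Ioi c, Real.exp (-u) * u ^ (a - 1) := by
        refine setIntegral_mono_on ((integrableOn_exp_neg_Ioi c).mul_const _)
          (hint.mono_set (Ioi_subset_Ioi hc.le)) measurableSet_Ioi fun u hu => ?_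
        have hu' : c < u := hu
        gcongr
    _ ≤ ∫ u in Ioi (0 : ℝ), Real.exp (-u) * u ^ (a - 1) := by
        refine setIntegral_mono_set hint ?_ (Ioi_subset_Ioi hc.le).eventuallyLE
        filter_upwards [ae_restrict_mem measurableSet_Ioi] with u hu
        have : (0 : ℝ) < u := hu
        positivity

lemma integrableOn_powerKernel_Ioi {t : ℝ} (ht : 0 < t) :
    IntegrableOn (fun a => powerKernel a t) (Ioi 0) := by
  have hcont := continuous_powerKernel ht
  rw [← Ioc_union_Ioi_eq_Ioi (zero_le_one (α := ℝ))]
  refine IntegrableOn.union ((hcont.integrableOn_Icc).mono_set Ioc_subset_Icc_self) ?_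
  -- beyond `a = 1`, compare with a geometric decay of ratio `1/2`
  have hexp : IntegrableOn (fun a : ℝ => Real.exp (2 * t) * (2 * Real.exp (-Real.log 2 * a)))
      (Ioi 1) :=
    ((integrableOn_exp_mul_Ioi (by simp [Real.log_pos]) 1).const_mul _).const_mul _
  refine Integrable.mono' hexp hcont.aestronglyMeasurable ?_
  filter_upwards [ae_restrict_mem measurableSet_Ioi] with a ha
  have ha' : (1 : ℝ) < a := ha
  rw [Real.norm_of_nonneg (powerKernel_pos (by linarith) ht).le, powerKernel,
    div_le_iff₀ (Real.Gamma_pos_of_pos (by linarith))]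
  have h1 := exp_neg_mul_rpow_le_Gamma ha'.le (c := 2 * t) (by positivity)
  have h2 : 2 * Real.exp (-Real.log 2 * a) = ((2 : ℝ) ^ (a - 1))⁻¹ := by
    rw [← Real.rpow_neg (by norm_num), Real.rpow_def_of_pos (by norm_num)]
    nth_rewrite 1 [← Real.exp_log (show (0 : ℝ) < 2 by norm_num)]
    rw [← Real.exp_add]; congr 1; ring
  calc t ^ (a - 1)
      = Real.exp (2 * t) * ((2 : ℝ) ^ (a - 1))⁻¹ * (Real.exp (-(2 * t)) * (2 * t) ^ (a - 1)) := by
        rw [Real.mul_rpow (by norm_num) ht.le, Real.exp_neg]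
        have : (2 : ℝ) ^ (a - 1) ≠ 0 := by positivity
        field_simp
    _ ≤ _ := by rw [← h2]; gcongr

lemma volterra_nonneg {t : ℝ} (ht : 0 < t) : 0 ≤ volterra t :=
  setIntegral_nonneg measurableSet_Ioi fun _ ha => (powerKernel_pos ha ht).le

lemma measurable_volterra : Measurable volterra :=
  (StronglyMeasurable.integral_prod_right (f := fun t a => powerKernel a t)
    (measurable_powerKernel.comp measurable_swap).stronglyMeasurable).measurable

/-- The semigroup law `ρ_a * ρ_b = ρ_{a+b}`, a form of Euler's Beta integral. -/
lemma integral_powerKernel_mul {a b t : ℝ} (ha : 0 < a) (hb : 0 < b) (ht : 0 < t) :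
    ∫ s in (0 : ℝ)..t, powerKernel a (t - s) * powerKernel b s = powerKernel (a + b) t := by
  have h1 := Complex.betaIntegral_scaled (b : ℂ) (a : ℂ) ht
  have h2 := Complex.Gamma_mul_Gamma_eq_betaIntegral (s := (b : ℂ)) (t := (a : ℂ))
    (by simpa using hb) (by simpa using ha)
  have ga := Real.Gamma_pos_of_pos ha
  have gb := Real.Gamma_pos_of_pos hb
  have gab := Real.Gamma_pos_of_pos (add_pos ha hb)
  have h3 : ((∫ s in (0 : ℝ)..t, s ^ (b - 1) * (t - s) ^ (a - 1) : ℝ) : ℂ)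
      = (t : ℂ) ^ ((b : ℂ) + a - 1) * Complex.betaIntegral b a := by
    rw [← h1, ← intervalIntegral.integral_ofReal]
    refine intervalIntegral.integral_congr fun s hs => ?_
    rw [uIcc_of_le ht.le] at hs
    simp only [Complex.ofReal_mul]
    rw [Complex.ofReal_cpow hs.1, Complex.ofReal_cpow (sub_nonneg.2 hs.2)]
    push_cast; rfl
  have h4 : Complex.betaIntegral b a
      = ((Real.Gamma b * Real.Gamma a / Real.Gamma (a + b) : ℝ) : ℂ) := by
    rw [Complex.Gamma_ofReal, Complex.Gamma_ofReal, ← Complex.ofReal_add, Complex.Gamma_ofReal,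
      add_comm b a] at h2
    push_cast
    rw [h2, mul_div_cancel_left₀]
    exact_mod_cast gab.ne'
  have h5 : (∫ s in (0 : ℝ)..t, s ^ (b - 1) * (t - s) ^ (a - 1))
      = t ^ (a + b - 1) * (Real.Gamma b * Real.Gamma a / Real.Gamma (a + b)) := by
    have : (t : ℂ) ^ ((b : ℂ) + a - 1) = ((t ^ (a + b - 1) : ℝ) : ℂ) := by
      rw [Complex.ofReal_cpow ht.le]; push_cast; rw [add_comm (b : ℂ)]
    rw [this, h4, ← Complex.ofReal_mul] at h3
    exact_mod_cast h3
  have h6 : ∀ s, powerKernel a (t - s) * powerKernel b s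
      = (s ^ (b - 1) * (t - s) ^ (a - 1)) * (Real.Gamma a * Real.Gamma b)⁻¹ := by
    intro s; unfold powerKernel; field_simp
  simp_rw [h6]
  rw [intervalIntegral.integral_mul_const, h5, powerKernel]
  field_simp

lemma lintegral_powerKernel_mul {a b t : ℝ} (ha : 0 < a) (hb : 0 < b) (ht : 0 < t) :
    ∫⁻ s in Ioo 0 t, ENNReal.ofReal (powerKernel a (t - s) * powerKernel b s)
      = ENNReal.ofReal (powerKernel (a + b) t) := by
  have h := integral_powerKernel_mul ha hb ht
  rw [intervalIntegral.integral_of_le ht.le, integral_Ioc_eq_integral_Ioo] at h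
  -- the integral is nonzero, hence not the junk value of a non-integrable function
  have hint : IntegrableOn (fun s => powerKernel a (t - s) * powerKernel b s) (Ioo 0 t) := by
    by_contra hn
    rw [integral_undef hn] at h
    exact (powerKernel_pos (add_pos ha hb) ht).ne h
  rw [← h, ofReal_integral_eq_lintegral_ofReal hint]
  filter_upwards [ae_restrict_mem measurableSet_Ioo] with s hs
  exact mul_nonneg (powerKernel_pos ha (sub_pos.2 hs.2)).le (powerKernel_pos hb hs.1).le

lemma lintegral_volterra_mul_powerKernel {b t : ℝ} (hb : 0 < b) (ht : 0 < t) :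
    ∫⁻ s in Ioo 0 t, ENNReal.ofReal (volterra (t - s) * powerKernel b s)
      = ENNReal.ofReal (∫ a in Ioi b, powerKernel a t) := by
  have e1 : ∀ s ∈ Ioo 0 t, ENNReal.ofReal (volterra (t - s) * powerKernel b s)
      = ∫⁻ a in Ioi (0 : ℝ), ENNReal.ofReal (powerKernel a (t - s) * powerKernel b s) := by
    intro s hs
    rw [volterra_eq, ← integral_mul_const, ofReal_integral_eq_lintegral_ofReal
      ((integrableOn_powerKernel_Ioi (sub_pos.2 hs.2)).mul_const _)]
    filter_upwards [ae_restrict_mem measurableSet_Ioi] with a ha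
    exact mul_nonneg (powerKernel_pos ha (sub_pos.2 hs.2)).le (powerKernel_pos hb hs.1).le
  have hm : Measurable fun p : ℝ × ℝ =>
      ENNReal.ofReal (powerKernel p.2 (t - p.1) * powerKernel b p.1) := by
    refine ENNReal.measurable_ofReal.comp (Measurable.mul ?_ ?_)
    · exact measurable_powerKernel.comp (measurable_snd.prodMk (measurable_fst.const_sub t))
    · exact measurable_powerKernel.comp (measurable_const.prodMk measurable_fst)
  rw [setLIntegral_congr_fun measurableSet_Ioo e1, lintegral_lintegral_swap hm.aemeasurable,
    setLIntegral_congr_fun measurableSet_Ioi fun a ha => lintegral_powerKernel_mul ha hb ht]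
  have hi : IntegrableOn (fun a => powerKernel a t) (Ioi b) :=
    (integrableOn_powerKernel_Ioi ht).mono_set (Ioi_subset_Ioi hb.le)
  have hshift : (Ioi (0 : ℝ)) = (fun a => a + b) ⁻¹' Ioi b := by ext a; simp
  rw [ofReal_integral_eq_lintegral_ofReal hi, hshift]
  · exact (measurePreserving_add_right volume b).setLIntegral_comp_preimage_emb
      (measurableEmbedding_addRight b) (fun a => ENNReal.ofReal (powerKernel a t)) _
  · filter_upwards [ae_restrict_mem measurableSet_Ioi] with a ha
    exact (powerKernel_pos (hb.trans ha) ht).le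

lemma integrableOn_volterra_mul_powerKernel {b t : ℝ} (hb : 0 < b) (ht : 0 < t) :
    IntegrableOn (fun s => volterra (t - s) * powerKernel b s) (Ioo 0 t) := by
  have hm : Measurable fun s => volterra (t - s) * powerKernel b s :=
    (measurable_volterra.comp (measurable_id.const_sub t)).mul
      (measurable_powerKernel.comp (measurable_const.prodMk measurable_id))
  refine (lintegral_ofReal_ne_top_iff_integrable hm.aestronglyMeasurable ?_).1 ?_
  · filter_upwards [ae_restrict_mem measurableSet_Ioo] with s hs
    exact mul_nonneg (volterra_nonneg (sub_pos.2 hs.2)) (powerKernel_pos hb hs.1).le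
  · rw [lintegral_volterra_mul_powerKernel hb ht]
    exact ENNReal.ofReal_ne_top

/-- Convolving `𝓘` with `ρ_b` truncates the superposition defining `𝓘`:
`𝓘 * ρ_b = ∫_b^∞ ρ_a da`. -/
lemma integral_volterra_mul_powerKernel {b t : ℝ} (hb : 0 < b) (ht : 0 < t) :
    ∫ s in Ioo 0 t, volterra (t - s) * powerKernel b s = ∫ a in Ioi b, powerKernel a t := by
  rw [integral_eq_lintegral_of_nonneg_ae, lintegral_volterra_mul_powerKernel hb ht,
    ENNReal.toReal_ofReal]
  · exact setIntegral_nonneg measurableSet_Ioi fun a ha => (powerKernel_pos (hb.trans ha) ht).le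
  · filter_upwards [ae_restrict_mem measurableSet_Ioo] with s hs
    exact mul_nonneg (volterra_nonneg (sub_pos.2 hs.2)) (powerKernel_pos hb hs.1).le
  · exact (integrableOn_volterra_mul_powerKernel hb ht).aestronglyMeasurable

lemma powerKernel_one (s : ℝ) : powerKernel 1 s = 1 := by simp [powerKernel]

lemma integrableOn_volterra {T : ℝ} (hT : 0 < T) : IntegrableOn volterra (Ioo 0 T) := by
  have h := integrableOn_volterra_mul_powerKernel one_pos hT
  simp only [powerKernel_one, mul_one] at h
  have hpre : Ioo 0 T = (fun s => T - s) ⁻¹' Ioo 0 T := by ext s; simp [and_comm]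
  rw [hpre] at h
  exact ((Measure.measurePreserving_sub_left volume T).integrableOn_comp_preimage
    (measurableEmbedding_subLeft T)).1 h

/-! ### The convolution of the Volterra function with the logarithm -/

lemma rpow_le_rpow_neg_add_rpow {s y c : ℝ} (hs : 0 < s) (h1 : -c ≤ y) (h2 : y ≤ c) :
    s ^ y ≤ s ^ (-c) + s ^ c := by
  rcases le_total s 1 with h | h
  · have := Real.rpow_le_rpow_of_exponent_ge hs h h1
    have := Real.rpow_nonneg hs.le c
    linarith
  · have := Real.rpow_le_rpow_of_exponent_le h h2
    have := Real.rpow_nonneg hs.le (-c)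
    linarith

lemma abs_log_le_rpow {s : ℝ} (hs : 0 < s) :
    |Real.log s| ≤ 4 * (s ^ (1 / 4 : ℝ) + s ^ (-(1 / 4) : ℝ)) := by
  have h1 := Real.log_le_rpow_div hs.le (show (0 : ℝ) < 1 / 4 by norm_num)
  have h2 := Real.log_le_rpow_div (inv_pos.2 hs).le (show (0 : ℝ) < 1 / 4 by norm_num)
  rw [Real.log_inv, Real.inv_rpow hs.le, ← Real.rpow_neg hs.le] at h2
  have h3 := Real.rpow_nonneg hs.le (1 / 4)
  have h4 := Real.rpow_nonneg hs.le (-(1 / 4))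
  rw [abs_le]
  constructor <;> linarith

lemma exists_continuous_hasDerivAt_inv_Gamma :
    ∃ g' : ℝ → ℝ, Continuous g' ∧ (∀ a, HasDerivAt (fun a => (Real.Gamma a)⁻¹) (g' a) a) ∧
      g' 1 = Real.eulerMascheroniConstant := by
  have hd := Complex.differentiable_one_div_Gamma
  have hderiv : ∀ a : ℝ, HasDerivAt (fun a => (Real.Gamma a)⁻¹)
      (deriv (fun z => (Complex.Gamma z)⁻¹) a).re a := by
    intro a
    have := (hd a).hasDerivAt.real_of_complex
    refine this.congr_of_eventuallyEq (Eventually.of_forall fun x => ?_)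
    simp only [Complex.Gamma_ofReal, ← Complex.ofReal_inv, Complex.ofReal_re]
  refine ⟨_, ?_, hderiv, ?_⟩
  · have : ContDiff ℂ 1 (fun z => (Complex.Gamma z)⁻¹) := hd.contDiff
    exact Complex.continuous_re.comp ((this.continuous_deriv le_rfl).comp
      Complex.continuous_ofReal)
  · have h := Real.hasDerivAt_Gamma_one.inv (by simp)
    simpa using (hderiv 1).unique h

lemma hasDerivAt_powerKernel {g' : ℝ → ℝ}
    (hg' : ∀ a, HasDerivAt (fun a => (Real.Gamma a)⁻¹) (g' a) a) {s : ℝ} (hs : 0 < s) (b : ℝ) :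
    HasDerivAt (fun b => powerKernel b s)
      (s ^ (b - 1) * (Real.log s * (Real.Gamma b)⁻¹ + g' b)) b := by
  have h1 : HasDerivAt (fun b : ℝ => s ^ (b - 1)) (Real.log s * 1 * s ^ (b - 1)) b :=
    ((hasDerivAt_id b).sub_const 1).const_rpow hs
  have := h1.mul (hg' b)
  unfold powerKernel
  simp only [div_eq_mul_inv]
  convert! this using 1
  ring

/-- The Sonine-type identity `𝓘 * (log + γ) = -1`: it is the derivative at `b = 1` of
`𝓘 * ρ_b = ∫_b^∞ ρ_a da`. -/
lemma integral_volterra_mul_log {t : ℝ} (ht : 0 < t) :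
    IntegrableOn (fun s => volterra (t - s) * (Real.log s + Real.eulerMascheroniConstant))
      (Ioo 0 t) ∧
    ∫ s in Ioo 0 t, volterra (t - s) * (Real.log s + Real.eulerMascheroniConstant) = -1 := by
  obtain ⟨g', hgc, hg', hg1⟩ := exists_continuous_hasDerivAt_inv_Gamma
  obtain ⟨K₁, hK₁⟩ := isCompact_Icc.exists_bound_of_continuousOn (s := Icc (1 / 2 : ℝ) (3 / 2))
    continuous_inv_Gamma.continuousOn
  obtain ⟨K₂, hK₂⟩ := isCompact_Icc.exists_bound_of_continuousOn (s := Icc (1 / 2 : ℝ) (3 / 2))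
    hgc.continuousOn
  have hVm : Measurable fun s => volterra (t - s) :=
    measurable_volterra.comp (measurable_id.const_sub t)
  -- for `|b - 1| ≤ 1/2` the derivative of `ρ_b(s)` is `O(s^{-3/4} + s^{3/4})`, and these powers are
  -- multiples of `ρ_{1/4}` and `ρ_{7/4}`, whose convolutions with `𝓘` are already known to be finite
  set bound : ℝ → ℝ := fun s =>
    (8 * K₁ + K₂) * (Real.Gamma (1 / 4) * (volterra (t - s) * powerKernel (1 / 4) s)
      + Real.Gamma (7 / 4) * (volterra (t - s) * powerKernel (7 / 4) s)) with hbound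
  have hdom := hasDerivAt_integral_of_dominated_loc_of_deriv_le (μ := volume.restrict (Ioo 0 t))
    (F := fun b s => volterra (t - s) * powerKernel b s)
    (F' := fun b s => volterra (t - s) * (s ^ (b - 1) * (Real.log s * (Real.Gamma b)⁻¹ + g' b)))
    (x₀ := 1) (s := Icc (1 / 2) (3 / 2)) (bound := bound)
    (Icc_mem_nhds (by norm_num) (by norm_num))
    (Eventually.of_forall fun b => (hVm.mul (measurable_powerKernel.comp
      (measurable_const.prodMk measurable_id))).aestronglyMeasurable)
    (integrableOn_volterra_mul_powerKernel one_pos ht) ?_ ?_ ?_ ?_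
  · have hR : HasDerivAt (fun b => ∫ s in Ioo 0 t, volterra (t - s) * powerKernel b s) (-1) 1 := by
      have hcont := continuous_powerKernel ht
      have h1 : HasDerivAt (fun b => (∫ a in Ioi (0 : ℝ), powerKernel a t)
          - ∫ a in (0 : ℝ)..b, powerKernel a t) (0 - powerKernel 1 t) 1 :=
        (hasDerivAt_const _ _).sub (intervalIntegral.integral_hasDerivAt_right
          (hcont.intervalIntegrable _ _) (hcont.stronglyMeasurableAtFilter _ _) hcont.continuousAt)
      rw [powerKernel_one, zero_sub] at h1
      refine h1.congr_of_eventuallyEq ?_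
      filter_upwards [lt_mem_nhds (show (0 : ℝ) < 1 by norm_num)] with b hb
      rw [integral_volterra_mul_powerKernel hb ht, ← intervalIntegral.integral_Ioi_sub_Ioi
        (integrableOn_powerKernel_Ioi ht) hb.le]
      ring
    have h := hdom.2.unique hR
    have h0 := hdom.1
    simp only [sub_self, Real.rpow_zero, Real.Gamma_one, inv_one, mul_one, one_mul, hg1] at h h0
    exact ⟨h0, h⟩
  · refine (hVm.mul ?_).aestronglyMeasurable
    simp only [sub_self, Real.rpow_zero, one_mul]
    exact (Real.measurable_log.mul_const _).add_const _
  · filter_upwards [ae_restrict_mem measurableSet_Ioo] with s hs b hb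
    have hs0 := hs.1
    have hV := volterra_nonneg (sub_pos.2 hs.2)
    have hp : ∀ c : ℝ, 0 < c → Real.Gamma c * (volterra (t - s) * powerKernel c s)
        = volterra (t - s) * s ^ (c - 1) := by
      intro c hc
      have := (Real.Gamma_pos_of_pos hc).ne'
      unfold powerKernel; field_simp
    rw [hbound]
    simp only
    rw [hp _ (by norm_num), hp _ (by norm_num), norm_mul, Real.norm_of_nonneg hV, ← mul_add,
      mul_left_comm]
    refine mul_le_mul_of_nonneg_left ?_ hV
    have k1 := hK₁ b hb
    have k2 := hK₂ b hb
    rw [norm_mul, Real.norm_of_nonneg (Real.rpow_nonneg hs0.le _)]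
    have hlog := abs_log_le_rpow hs0
    have e1 := rpow_le_rpow_neg_add_rpow (y := b - 1 + 1 / 4) (c := 3 / 4) hs0
      (by linarith [hb.1]) (by linarith [hb.2])
    have e2 := rpow_le_rpow_neg_add_rpow (y := b - 1 + -(1 / 4)) (c := 3 / 4) hs0
      (by linarith [hb.1]) (by linarith [hb.2])
    have e3 := rpow_le_rpow_neg_add_rpow (y := b - 1) (c := 3 / 4) hs0
      (by linarith [hb.1]) (by linarith [hb.2])
    rw [Real.rpow_add hs0] at e1 e2
    have hpos : 0 ≤ s ^ (b - 1) := Real.rpow_nonneg hs0.le _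
    have hK1 : 0 ≤ K₁ := (norm_nonneg _).trans k1
    have hK2 : 0 ≤ K₂ := (norm_nonneg _).trans k2
    rw [show (1 / 4 - 1 : ℝ) = -(3 / 4) by norm_num, show (7 / 4 - 1 : ℝ) = 3 / 4 by norm_num]
    set X := s ^ (-(3 / 4) : ℝ) + s ^ (3 / 4 : ℝ)
    calc s ^ (b - 1) * ‖Real.log s * (Real.Gamma b)⁻¹ + g' b‖
        ≤ s ^ (b - 1) * (4 * (s ^ (1 / 4 : ℝ) + s ^ (-(1 / 4) : ℝ)) * K₁ + K₂) := by
          gcongr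
          refine (norm_add_le _ _).trans ?_
          rw [norm_mul]
          gcongr
          exact hlog
      _ = 4 * K₁ * (s ^ (b - 1) * s ^ (1 / 4 : ℝ)) + 4 * K₁ * (s ^ (b - 1) * s ^ (-(1 / 4) : ℝ))
          + K₂ * s ^ (b - 1) := by ring
      _ ≤ 4 * K₁ * X + 4 * K₁ * X + K₂ * X := by gcongr
      _ = (8 * K₁ + K₂) * X := by ring
  · exact (((integrableOn_volterra_mul_powerKernel (by norm_num) ht).const_mul _).add
      ((integrableOn_volterra_mul_powerKernel (by norm_num) ht).const_mul _)).const_mul _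
  · filter_upwards [ae_restrict_mem measurableSet_Ioo] with s hs b _
    exact (hasDerivAt_powerKernel hg' hs.1 b).const_mul _

/-! ### Convolutions of integrable and translation-Lipschitz functions -/

/-- Young's inequality in weighted `L¹`, for a weight that is a character of `(ℝ, +)`. -/
lemma lintegral_mul_enorm_convolution_le {θ : ℝ → ℝ≥0∞} (hθ : Measurable θ)
    (hadd : ∀ s t, θ (s + t) = θ s * θ t) {k : ℝ → ℝ} {u : ℝ → ℂ}
    (hk : AEStronglyMeasurable k) (hu : AEStronglyMeasurable u) :
    ∫⁻ x, θ x * ‖(k ⋆ u) x‖ₑ ≤ (∫⁻ x, θ x * ‖k x‖ₑ) * ∫⁻ x, θ x * ‖u x‖ₑ := by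
  have hmeas : AEMeasurable (fun p : ℝ × ℝ => (θ p.2 * ‖k p.2‖ₑ) * (θ (p.1 - p.2) *
      ‖u (p.1 - p.2)‖ₑ)) (volume.prod volume) := by
    refine AEMeasurable.mul ?_ ?_
    · exact (hθ.comp measurable_snd).aemeasurable.mul
        (hk.enorm.comp_quasiMeasurePreserving Measure.quasiMeasurePreserving_snd)
    · exact (hθ.comp (measurable_fst.sub measurable_snd)).aemeasurable.mul
        (hu.enorm.comp_quasiMeasurePreserving
          (quasiMeasurePreserving_sub_of_right_invariant volume volume))
  calc ∫⁻ x, θ x * ‖(k ⋆ u) x‖ₑ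
      ≤ ∫⁻ x, ∫⁻ t, (θ t * ‖k t‖ₑ) * (θ (x - t) * ‖u (x - t)‖ₑ) := by
        refine lintegral_mono fun x => ?_
        rw [convolution_lsmul]
        calc θ x * ‖∫ t, k t • u (x - t)‖ₑ ≤ θ x * ∫⁻ t, ‖k t • u (x - t)‖ₑ := by
              gcongr; exact enorm_integral_le_lintegral_enorm _
          _ ≤ ∫⁻ t, θ x * ‖k t • u (x - t)‖ₑ := lintegral_const_mul_le _ _
          _ = _ := by
              refine lintegral_congr fun t => ?_
              rw [enorm_smul]
              nth_rewrite 1 [← add_sub_cancel t x]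
              rw [hadd]; ring
    _ = ∫⁻ t, ∫⁻ x, (θ t * ‖k t‖ₑ) * (θ (x - t) * ‖u (x - t)‖ₑ) :=
        lintegral_lintegral_swap hmeas
    _ = ∫⁻ t, (θ t * ‖k t‖ₑ) * ∫⁻ x, θ x * ‖u x‖ₑ := by
        refine lintegral_congr fun t => ?_
        rw [lintegral_const_mul'', lintegral_sub_right_eq_self (fun x => θ x * ‖u x‖ₑ)]
        exact (hθ.aemeasurable.mul hu.enorm).comp_quasiMeasurePreserving
          (measurePreserving_sub_right volume t).quasiMeasurePreserving
    _ = _ := by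
        exact lintegral_mul_const'' _ (hθ.aemeasurable.mul hk.enorm)

lemma lintegral_enorm_convolution_le {k : ℝ → ℝ} {u : ℝ → ℂ}
    (hk : AEStronglyMeasurable k) (hu : AEStronglyMeasurable u) :
    ∫⁻ x, ‖(k ⋆ u) x‖ₑ ≤ (∫⁻ x, ‖k x‖ₑ) * ∫⁻ x, ‖u x‖ₑ := by
  simpa using lintegral_mul_enorm_convolution_le (θ := fun _ => 1) measurable_const
    (fun _ _ => (one_mul 1).symm) hk hu

/-- `u` is `L¹`-Lipschitz under small translations; on the line this is bounded variation, up to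
modification on a null set. -/
def TranslationLipschitz (u : ℝ → ℂ) : Prop :=
  ∃ C : ℝ≥0∞, C ≠ ⊤ ∧ ∃ r > 0, ∀ δ ∈ Ioo (0 : ℝ) r,
    ∫⁻ x, ‖u (x + δ) - u x‖ₑ ≤ C * ENNReal.ofReal δ

lemma convolution_comp_add_right (k : ℝ → ℝ) (u : ℝ → ℂ) (δ x : ℝ) :
    (k ⋆ fun y => u (y + δ)) x = (k ⋆ u) (x + δ) := by
  simp only [convolution_lsmul]
  congr 1; ext t; congr 2; ring

/-- If translations move `u` by at most `C δ` in `L¹`, then `‖w' * u‖₁ ≤ C ‖w‖₁` for test functions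
`w`, by Fatou's lemma applied to the difference quotients of `w * u`. -/
lemma lintegral_deriv_convolution_le {u : ℝ → ℂ} (hu : Integrable u) {C : ℝ≥0∞} {r : ℝ}
    (hr : 0 < r)
    (hC : ∀ δ ∈ Ioo (0 : ℝ) r, ∫⁻ x, ‖u (x + δ) - u x‖ₑ ≤ C * ENNReal.ofReal δ)
    {w : ℝ → ℝ} (hw : HasCompactSupport w) (hws : ContDiff ℝ 1 w) :
    ∫⁻ x, ‖(deriv w ⋆ u) x‖ₑ ≤ C * ∫⁻ x, ‖w x‖ₑ := by
  have hwm : AEStronglyMeasurable w := hws.continuous.aestronglyMeasurable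
  have hder : ∀ x, HasDerivAt (w ⋆ u) ((deriv w ⋆ u) x) x := fun x =>
    hw.hasDerivAt_convolution_left _ hws hu.locallyIntegrable x
  have hcont : Continuous (w ⋆ u) :=
    hw.continuous_convolution_left _ hws.continuous hu.locallyIntegrable
  obtain ⟨δ, -, hδ, hδ0⟩ := exists_seq_strictAnti_tendsto' hr
  have hlim : ∀ x, Tendsto (fun n => ‖(δ n)⁻¹ • ((w ⋆ u) (x + δ n) - (w ⋆ u) x)‖ₑ) atTop
      (𝓝 ‖(deriv w ⋆ u) x‖ₑ) := by
    intro x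
    refine (Tendsto.enorm ?_)
    refine (hasDerivAt_iff_tendsto_slope_zero.1 (hder x)).comp ?_
    exact tendsto_nhdsWithin_iff.2 ⟨hδ0, Eventually.of_forall fun n => (hδ n).1.ne'⟩
  calc ∫⁻ x, ‖(deriv w ⋆ u) x‖ₑ
      = ∫⁻ x, liminf (fun n => ‖(δ n)⁻¹ • ((w ⋆ u) (x + δ n) - (w ⋆ u) x)‖ₑ) atTop :=
        lintegral_congr fun x => (hlim x).liminf_eq.symm
    _ ≤ liminf (fun n => ∫⁻ x, ‖(δ n)⁻¹ • ((w ⋆ u) (x + δ n) - (w ⋆ u) x)‖ₑ) atTop := by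
        refine lintegral_liminf_le fun n => ?_
        have hc : Continuous fun x => (w ⋆ u) (x + δ n) - (w ⋆ u) x :=
          (hcont.comp (continuous_add_const _)).sub hcont
        exact (hc.const_smul (δ n)⁻¹).measurable.enorm
    _ ≤ liminf (fun _ : ℕ => C * ∫⁻ x, ‖w x‖ₑ) atTop := by
        refine liminf_le_liminf (Eventually.of_forall fun n => ?_)
        have hδn := (hδ n).1
        have heq : ∀ x, (w ⋆ u) (x + δ n) - (w ⋆ u) x = (w ⋆ fun y => u (y + δ n) - u y) x := by
          intro x
          rw [← convolution_comp_add_right]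
          simp only [convolution_lsmul, smul_sub]
          rw [integral_sub]
          · exact hw.convolutionExists_left (ContinuousLinearMap.lsmul ℝ ℝ) hws.continuous
              (hu.comp_add_right (δ n)).locallyIntegrable x
          · exact hw.convolutionExists_left (ContinuousLinearMap.lsmul ℝ ℝ) hws.continuous
              hu.locallyIntegrable x
        simp only [enorm_smul, heq]
        rw [lintegral_const_mul' _ _ enorm_ne_top]
        calc ‖(δ n)⁻¹‖ₑ * ∫⁻ x, ‖(w ⋆ fun y => u (y + δ n) - u y) x‖ₑ
            ≤ ‖(δ n)⁻¹‖ₑ * ((∫⁻ x, ‖w x‖ₑ) * (C * ENNReal.ofReal (δ n))) := by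
              gcongr
              refine (lintegral_enorm_convolution_le hwm
                ((hu.comp_add_right (δ n)).sub hu).aestronglyMeasurable).trans ?_
              gcongr
              exact hC _ (hδ n)
          _ = (‖(δ n)⁻¹‖ₑ * ENNReal.ofReal (δ n)) * (C * ∫⁻ x, ‖w x‖ₑ) := by ring
          _ = C * ∫⁻ x, ‖w x‖ₑ := by
              rw [Real.enorm_eq_ofReal (inv_pos.2 hδn).le, ← ENNReal.ofReal_mul (inv_pos.2 hδn).le,
                inv_mul_cancel₀ hδn.ne', ENNReal.ofReal_one, one_mul]
    _ = C * ∫⁻ x, ‖w x‖ₑ := by simp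

lemma tendsto_integral_smul_of_L1 {η : ℝ → ℝ} (hη : Continuous η) (hηc : HasCompactSupport η)
    {f : ℕ → ℝ → ℂ} {g : ℝ → ℂ} (hf : ∀ n, Integrable (f n)) (hg : Integrable g)
    (h : Tendsto (fun n => ∫⁻ x, ‖f n x - g x‖ₑ) atTop (𝓝 0)) :
    Tendsto (fun n => ∫ x, η x • f n x) atTop (𝓝 (∫ x, η x • g x)) := by
  obtain ⟨M, hM⟩ := hηc.exists_bound_of_continuous hη
  have hM0 : 0 ≤ M := (norm_nonneg _).trans (hM 0)
  refine tendsto_integral_of_L1 _ (hη.aestronglyMeasurable.smul hg.aestronglyMeasurable)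
    (Eventually.of_forall fun n => (hf n).bdd_smul M hη.aestronglyMeasurable
      (Eventually.of_forall hM)) ?_
  have h2 : Tendsto (fun n => ENNReal.ofReal M * ∫⁻ x, ‖f n x - g x‖ₑ) atTop (𝓝 0) := by
    simpa using ENNReal.Tendsto.const_mul h (Or.inr ENNReal.ofReal_ne_top)
  refine tendsto_of_tendsto_of_tendsto_of_le_of_le tendsto_const_nhds h2 (fun _ => zero_le)
    fun n => ?_
  simp only
  rw [← lintegral_const_mul' _ _ ENNReal.ofReal_ne_top]
  refine lintegral_mono fun x => ?_
  rw [Pi.smul_apply', ← smul_sub, enorm_smul]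
  gcongr
  rw [← ofReal_norm]
  exact ENNReal.ofReal_le_ofReal (hM x)

/-- Convolution with an integrable kernel turns a translation-Lipschitz function into one with an
integrable weak derivative: the map `k ↦ k' * u` on test functions is bounded in `L¹`, hence extends
continuously to every `k ∈ L¹`. -/
theorem exists_weakDeriv_convolution {k : ℝ → ℝ} {u : ℝ → ℂ} (hk : Integrable k)
    (hu : Integrable u) (hlip : TranslationLipschitz u) :
    ∃ v : ℝ → ℂ, Integrable v ∧ ∀ η : ℝ → ℝ, ContDiff ℝ ∞ η → HasCompactSupport η →
      ∫ t, deriv η t • (k ⋆ u) t = -∫ t, η t • v t := by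
  obtain ⟨C, hCtop, r, hr, hC⟩ := hlip
  have hε : ∀ n : ℕ, (0 : ℝ) < (1 / 2) ^ n := fun n => by positivity
  choose w hwc hws hwk using fun n =>
    (memLp_one_iff_integrable.2 hk).exist_eLpNorm_sub_le ENNReal.one_ne_top le_rfl (hε n)
  have hws1 : ∀ n, ContDiff ℝ 1 (w n) := fun n => (hws n).of_le (by exact_mod_cast le_top)
  have hwi : ∀ n, Integrable (w n) := fun n =>
    (hws n).continuous.integrable_of_hasCompactSupport (hwc n)
  have hwk' : ∀ n, ∫⁻ x, ‖w n x - k x‖ₑ ≤ ENNReal.ofReal ((1 / 2) ^ n) := by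
    intro n
    refine le_trans (le_of_eq ?_) (hwk n)
    rw [eLpNorm_one_eq_lintegral_enorm]
    refine lintegral_congr fun x => ?_
    rw [Pi.sub_apply, enorm_sub_rev]
  have hdw : ∀ n, Integrable (deriv (w n)) := fun n =>
    ((hws1 n).continuous_deriv le_rfl).integrable_of_hasCompactSupport (hwc n).deriv
  have hv : ∀ n, Integrable (deriv (w n) ⋆ u) := fun n =>
    (hdw n).integrable_convolution _ hu
  have hconvk : Integrable (k ⋆ u) := hk.integrable_convolution _ hu
  -- the derivatives `(w n)' * u` form a Cauchy sequence in `L¹`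
  have hcau : ∀ n m, eLpNorm ((deriv (w n) ⋆ u) - (deriv (w m) ⋆ u)) 1 volume
      ≤ C * (ENNReal.ofReal ((1 / 2) ^ n) + ENNReal.ofReal ((1 / 2) ^ m)) := by
    intro n m
    have e : ∀ x, ((deriv (w n) ⋆ u) - (deriv (w m) ⋆ u)) x = (deriv (w n - w m) ⋆ u) x := by
      intro x
      have hd : deriv (w n - w m) = fun t => deriv (w n) t - deriv (w m) t := by
        ext t
        exact deriv_sub ((hws1 n).differentiable one_ne_zero t)
          ((hws1 m).differentiable one_ne_zero t)
      rw [hd, Pi.sub_apply]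
      simp only [convolution_lsmul, sub_smul]
      rw [integral_sub]
      · exact (hwc n).deriv.convolutionExists_left (ContinuousLinearMap.lsmul ℝ ℝ)
          ((hws1 n).continuous_deriv le_rfl) hu.locallyIntegrable x
      · exact (hwc m).deriv.convolutionExists_left (ContinuousLinearMap.lsmul ℝ ℝ)
          ((hws1 m).continuous_deriv le_rfl) hu.locallyIntegrable x
    rw [eLpNorm_one_eq_lintegral_enorm, lintegral_congr fun x => by rw [e x]]
    refine (lintegral_deriv_convolution_le hu hr hC ((hwc n).sub (hwc m))
      ((hws1 n).sub (hws1 m))).trans ?_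
    gcongr
    calc ∫⁻ x, ‖(w n - w m) x‖ₑ ≤ ∫⁻ x, (‖w n x - k x‖ₑ + ‖w m x - k x‖ₑ) := by
          refine lintegral_mono fun x => ?_
          have : (w n - w m) x = (w n x - k x) - (w m x - k x) := by simp
          rw [this]; exact enorm_sub_le
      _ = (∫⁻ x, ‖w n x - k x‖ₑ) + ∫⁻ x, ‖w m x - k x‖ₑ :=
          lintegral_add_left' ((hwi n).sub hk).aestronglyMeasurable.enorm _
      _ ≤ _ := add_le_add (hwk' n) (hwk' m)
  have hB : ∑' N : ℕ, (2 * C + 1) * ENNReal.ofReal ((1 / 2) ^ N) ≠ ⊤ := by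
    rw [ENNReal.tsum_mul_left, ← ENNReal.ofReal_tsum_of_nonneg (fun n => (hε n).le)
      (summable_geometric_of_lt_one (by norm_num) (by norm_num))]
    exact ENNReal.mul_ne_top (by finiteness) ENNReal.ofReal_ne_top
  obtain ⟨v, hvL, hvlim⟩ := Lp.cauchy_complete_eLpNorm le_rfl
    (fun n => memLp_one_iff_integrable.2 (hv n)) hB (by
      intro N n m hn hm
      have hmono : ∀ j, N ≤ j →
          ENNReal.ofReal ((1 / 2 : ℝ) ^ j) ≤ ENNReal.ofReal ((1 / 2) ^ N) := fun j hj =>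
        ENNReal.ofReal_le_ofReal (pow_le_pow_of_le_one (by norm_num) (by norm_num) hj)
      have hpos : ENNReal.ofReal ((1 / 2 : ℝ) ^ N) ≠ 0 := by
        simp
      calc _ ≤ C * (ENNReal.ofReal ((1 / 2) ^ n) + ENNReal.ofReal ((1 / 2) ^ m)) := hcau n m
        _ ≤ C * (ENNReal.ofReal ((1 / 2) ^ N) + ENNReal.ofReal ((1 / 2) ^ N)) := by
            gcongr C * ?_
            exact add_le_add (hmono n hn) (hmono m hm)
        _ = 2 * C * ENNReal.ofReal ((1 / 2) ^ N) := by ring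
        _ < (2 * C + 1) * ENNReal.ofReal ((1 / 2) ^ N) := by
            rw [add_mul, one_mul]
            exact ENNReal.lt_add_right (by finiteness) hpos)
  have hvi := memLp_one_iff_integrable.1 hvL
  refine ⟨v, hvi, fun η hη hηc => ?_⟩
  have hη1 : ContDiff ℝ 1 η := hη.of_le (by exact_mod_cast le_top)
  have hparts : ∀ n, ∫ t, deriv η t • (w n ⋆ u) t = -∫ t, η t • (deriv (w n) ⋆ u) t := by
    intro n
    have hcont : Continuous (w n ⋆ u) :=
      (hwc n).continuous_convolution_left _ (hws n).continuous hu.locallyIntegrable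
    have hcont' : Continuous (deriv (w n) ⋆ u) :=
      (hwc n).deriv.continuous_convolution_left _ ((hws1 n).continuous_deriv le_rfl)
        hu.locallyIntegrable
    have hd : ∀ t, HasDerivAt η (deriv η t) t := fun t =>
      (hη1.differentiable one_ne_zero t).hasDerivAt
    have := integral_bilinear_hasDerivAt_right_eq_neg_left_of_integrable
      (L := ContinuousLinearMap.lsmul ℝ ℝ (E := ℂ)) (u := η) (u' := deriv η)
      (v := (w n ⋆ u)) (v' := (deriv (w n) ⋆ u)) (fun t _ => hd t)
      (fun t _ => (hwc n).hasDerivAt_convolution_left _ (hws1 n) hu.locallyIntegrable t)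
      ((hη1.continuous.smul hcont').integrable_of_hasCompactSupport hηc.smul_right)
      (((hη1.continuous_deriv le_rfl).smul hcont).integrable_of_hasCompactSupport
        hηc.deriv.smul_right)
      ((hη1.continuous.smul hcont).integrable_of_hasCompactSupport hηc.smul_right)
    simp only [ContinuousLinearMap.lsmul_apply] at this
    rw [this, neg_neg]
  have hl1 : Tendsto (fun n => ∫ t, deriv η t • (w n ⋆ u) t) atTop
      (𝓝 (∫ t, deriv η t • (k ⋆ u) t)) := by
    refine tendsto_integral_smul_of_L1 (hη1.continuous_deriv le_rfl) hηc.deriv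
      (fun n => (hwi n).integrable_convolution _ hu) hconvk ?_
    have hb : ∀ n, ∫⁻ x, ‖(w n ⋆ u) x - (k ⋆ u) x‖ₑ
        ≤ ENNReal.ofReal ((1 / 2) ^ n) * ∫⁻ x, ‖u x‖ₑ := by
      intro n
      have hae : ∀ᵐ x, (w n ⋆ u) x - (k ⋆ u) x = ((fun t => w n t - k t) ⋆ u) x := by
        filter_upwards [hk.ae_convolution_exists (ContinuousLinearMap.lsmul ℝ ℝ) hu] with x hx
        simp only [convolution_lsmul, sub_smul]
        exact (integral_sub ((hwc n).convolutionExists_left (ContinuousLinearMap.lsmul ℝ ℝ)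
          (hws n).continuous hu.locallyIntegrable x) hx).symm
      rw [lintegral_congr_ae (hae.mono fun x hx => by simp only [hx]; rfl)]
      refine (lintegral_enorm_convolution_le ((hwi n).sub hk).aestronglyMeasurable
        hu.aestronglyMeasurable).trans ?_
      gcongr
      exact hwk' n
    have hz : Tendsto (fun n : ℕ => ENNReal.ofReal ((1 / 2) ^ n) * ∫⁻ x, ‖u x‖ₑ) atTop (𝓝 0) := by
      have : Tendsto (fun n : ℕ => ENNReal.ofReal ((1 / 2) ^ n)) atTop (𝓝 0) := by
        simpa using ENNReal.tendsto_ofReal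
          (tendsto_pow_atTop_nhds_zero_of_lt_one (r := (1 / 2 : ℝ)) (by norm_num) (by norm_num))
      simpa using ENNReal.Tendsto.mul_const this (Or.inr hu.2.ne)
    exact tendsto_of_tendsto_of_tendsto_of_le_of_le tendsto_const_nhds hz (fun _ => zero_le) hb
  have hl2 : Tendsto (fun n => -∫ t, η t • (deriv (w n) ⋆ u) t) atTop
      (𝓝 (-∫ t, η t • v t)) := by
    refine (tendsto_integral_smul_of_L1 hη1.continuous hηc hv hvi ?_).neg
    simpa [eLpNorm_one_eq_lintegral_enorm] using hvlim
  simp_rw [hparts] at hl1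
  exact tendsto_nhds_unique hl1 hl2

/-! ### Translation estimates for Volterra equations -/

/-- The points within `δ` to the left of an endpoint of `(0, T)`: the only ones where the increment
`u (x + δ) - u x` of a function `u` vanishing off `(0, T)` involves a jump at an endpoint. -/
def endpointStrip (T δ : ℝ) : Set ℝ := Icc (-δ) 0 ∪ Icc (T - δ) T

lemma measurableSet_endpointStrip (T δ : ℝ) : MeasurableSet (endpointStrip T δ) :=
  measurableSet_Icc.union measurableSet_Icc

lemma volume_endpointStrip_le (T δ : ℝ) :
    volume (endpointStrip T δ) ≤ 2 * ENNReal.ofReal δ := by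
  refine (measure_union_le _ _).trans ?_
  rw [Real.volume_Icc, Real.volume_Icc, two_mul]
  simp

/-- Off the endpoint strip, either both `x` and `x + δ` lie in `(0, T)` or neither does. -/
lemma mem_or_notMem_of_notMem_endpointStrip {T δ x : ℝ} (hδ : 0 < δ)
    (hx : x ∉ endpointStrip T δ) :
    (0 < x ∧ x < T - δ) ∨ (x ∉ Ioo 0 T ∧ x + δ ∉ Ioo 0 T) := by
  simp only [endpointStrip, mem_union, mem_Icc, not_or, not_and, not_le, mem_Ioo, not_lt] at *
  obtain ⟨h1, h2⟩ := hx
  by_cases h : 0 < x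
  · by_cases h' : x < T - δ
    · exact Or.inl ⟨h, h'⟩
    · have := h2 (not_lt.1 h')
      exact Or.inr ⟨fun _ => this.le, fun _ => by linarith⟩
  · have : x < -δ := by
      by_contra hc
      exact h (h1 (not_lt.1 hc))
    exact Or.inr ⟨fun h3 => by linarith, fun h3 => by linarith⟩

lemma lintegral_indicator_endpointStrip_le (T δ : ℝ) (M : ℝ≥0∞) :
    ∫⁻ x, (endpointStrip T δ).indicator (fun _ => M) x ≤ 2 * M * ENNReal.ofReal δ := by
  rw [lintegral_indicator_const (measurableSet_endpointStrip T δ)]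
  calc _ ≤ M * (2 * ENNReal.ofReal δ) := by gcongr; exact volume_endpointStrip_le T δ
    _ = _ := by ring

lemma enorm_le_ofReal {z : ℂ} {B : ℝ} (h : ‖z‖ ≤ B) : ‖z‖ₑ ≤ ENNReal.ofReal B := by
  rw [← ofReal_norm]; exact ENNReal.ofReal_le_ofReal h

lemma integrable_of_bounded_support {u : ℝ → ℂ} (hm : AEStronglyMeasurable u) {B T : ℝ}
    (hB : ∀ t, ‖u t‖ ≤ B) (h0 : ∀ t ∉ Ioo 0 T, u t = 0) : Integrable u := by
  have : IntegrableOn u (Ioo 0 T) :=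
    Measure.integrableOn_of_bounded (M := B) (by simp) hm (Eventually.of_forall hB)
  rwa [integrableOn_iff_integrable_of_support_subset] at this
  intro t ht
  by_contra h
  exact ht (h0 t h)

/-- A function on `(0, T)` whose increments are dominated by those of a monotone function is
translation-Lipschitz after extension by zero. -/
lemma translationLipschitz_indicator {T B : ℝ} (hT : 0 < T) {F : ℝ → ℂ} {G : ℝ → ℝ}
    (hG : Monotone G) (hF : ∀ s t, 0 < s → s ≤ t → t < T → ‖F t - F s‖ ≤ G t - G s)
    (hB : ∀ t ∈ Ioo 0 T, ‖F t‖ ≤ B) : TranslationLipschitz ((Ioo 0 T).indicator F) := by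
  have hB' : ∀ t, ‖(Ioo 0 T).indicator F t‖ ≤ |B| := by
    intro t
    by_cases h : t ∈ Ioo 0 T
    · rw [indicator_of_mem h]; exact (hB t h).trans (le_abs_self B)
    · rw [indicator_of_notMem h]; simp
  refine ⟨2 * ENNReal.ofReal (2 * |B|) + ENNReal.ofReal (G T - G 0), by finiteness, T, hT,
    fun δ hδ => ?_⟩
  have hpt : ∀ x, ‖(Ioo 0 T).indicator F (x + δ) - (Ioo 0 T).indicator F x‖ₑ
      ≤ (endpointStrip T δ).indicator (fun _ => ENNReal.ofReal (2 * |B|)) x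
        + (Ioc 0 (T - δ)).indicator (fun x => ENNReal.ofReal (G (x + δ) - G x)) x := by
    intro x
    by_cases hx : x ∈ endpointStrip T δ
    · refine le_add_right ?_
      rw [indicator_of_mem hx]
      refine enorm_le_ofReal ((norm_sub_le _ _).trans ?_)
      linarith [hB' x, hB' (x + δ)]
    · rcases mem_or_notMem_of_notMem_endpointStrip hδ.1 hx with h | h
      · refine le_add_left ?_
        rw [indicator_of_mem (show x + δ ∈ Ioo 0 T from ⟨by linarith [hδ.1], by linarith⟩),
          indicator_of_mem (show x ∈ Ioo 0 T from ⟨h.1, by linarith [hδ.1]⟩),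
          indicator_of_mem (show x ∈ Ioc 0 (T - δ) from ⟨h.1, h.2.le⟩)]
        exact enorm_le_ofReal (hF _ _ h.1 (by linarith [hδ.1]) (by linarith))
      · rw [indicator_of_notMem h.1, indicator_of_notMem h.2]
        simp
  have hint : ∀ a b, IntervalIntegrable G volume a b := fun a b => hG.intervalIntegrable
  have hmain : ∫ x in (0 : ℝ)..(T - δ), (G (x + δ) - G x) ≤ (G T - G 0) * δ := by
    have hs : IntervalIntegrable (fun x => G (x + δ)) volume 0 (T - δ) := by
      have : Monotone fun x => G (x + δ) := fun a b h => hG (by linarith)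
      exact this.intervalIntegrable
    rw [intervalIntegral.integral_sub hs (hint _ _), intervalIntegral.integral_comp_add_right,
      zero_add, sub_add_cancel]
    have e : (∫ x in δ..T, G x) - ∫ x in (0 : ℝ)..(T - δ), G x
        = (∫ x in (T - δ)..T, G x) - ∫ x in (0 : ℝ)..δ, G x := by
      have h1 := intervalIntegral.integral_add_adjacent_intervals (hint 0 δ) (hint δ T)
      have h2 := intervalIntegral.integral_add_adjacent_intervals (hint 0 (T - δ)) (hint (T - δ) T)
      linarith
    have u1 : (∫ x in (T - δ)..T, G x) ≤ ∫ x in (T - δ)..T, G T :=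
      intervalIntegral.integral_mono_on (by linarith [hδ.1]) (hint _ _) (by simp)
        fun x hx => hG hx.2
    have u2 : (∫ x in (0 : ℝ)..δ, G 0) ≤ ∫ x in (0 : ℝ)..δ, G x :=
      intervalIntegral.integral_mono_on hδ.1.le (by simp) (hint _ _) fun x hx => hG hx.1
    rw [intervalIntegral.integral_const, smul_eq_mul] at u1 u2
    rw [e]; nlinarith
  calc ∫⁻ x, ‖(Ioo 0 T).indicator F (x + δ) - (Ioo 0 T).indicator F x‖ₑ
      ≤ ∫⁻ x, ((endpointStrip T δ).indicator (fun _ => ENNReal.ofReal (2 * |B|)) x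
        + (Ioc 0 (T - δ)).indicator (fun x => ENNReal.ofReal (G (x + δ) - G x)) x) :=
        lintegral_mono hpt
    _ = (∫⁻ x, (endpointStrip T δ).indicator (fun _ => ENNReal.ofReal (2 * |B|)) x)
        + ∫⁻ x in Ioc 0 (T - δ), ENNReal.ofReal (G (x + δ) - G x) := by
        rw [lintegral_add_left (measurable_const.indicator (measurableSet_endpointStrip T δ)),
          lintegral_indicator measurableSet_Ioc]
    _ ≤ 2 * ENNReal.ofReal (2 * |B|) * ENNReal.ofReal δ + ENNReal.ofReal ((G T - G 0) * δ) := by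
        gcongr
        · exact lintegral_indicator_endpointStrip_le T δ _
        · rw [intervalIntegral.integral_of_le (by linarith [hδ.2])] at hmain
          rw [← ofReal_integral_eq_lintegral_ofReal]
          · exact ENNReal.ofReal_le_ofReal hmain
          · have : Monotone fun x => G (x + δ) := fun a b h => hG (by linarith)
            exact (this.intervalIntegrable (a := 0) (b := T - δ)).1.sub (hint 0 (T - δ)).1
          · exact Eventually.of_forall fun x => sub_nonneg.2 (hG (by linarith [hδ.1]))
    _ = _ := by
        rw [ENNReal.ofReal_mul (sub_nonneg.2 (hG hT.le)), add_mul]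

/-- The exponential weight `x ↦ e^{-n x}`. -/
noncomputable def expWeight (n : ℕ) (x : ℝ) : ℝ≥0∞ := ENNReal.ofReal (Real.exp (-(n * x)))

lemma measurable_expWeight (n : ℕ) : Measurable (expWeight n) := by
  unfold expWeight; fun_prop

lemma expWeight_add (n : ℕ) (s t : ℝ) : expWeight n (s + t) = expWeight n s * expWeight n t := by
  unfold expWeight
  rw [← ENNReal.ofReal_mul (Real.exp_pos _).le, ← Real.exp_add]
  congr 2; ring

lemma expWeight_le {n : ℕ} {x y : ℝ} (h : y ≤ x) : expWeight n x ≤ expWeight n y := by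
  unfold expWeight
  refine ENNReal.ofReal_le_ofReal (Real.exp_le_exp.2 (neg_le_neg ?_))
  gcongr

lemma expWeight_zero (n : ℕ) : expWeight n 0 = 1 := by simp [expWeight]

lemma tendsto_lintegral_expWeight_mul {k : ℝ → ℝ} (hk : Integrable k) (hk0 : ∀ t ≤ 0, k t = 0) :
    Tendsto (fun n => ∫⁻ x, expWeight n x * ‖k x‖ₑ) atTop (𝓝 0) := by
  have h := tendsto_lintegral_of_dominated_convergence' (μ := volume)
    (F := fun n x => expWeight n x * ‖k x‖ₑ) (f := fun _ => 0) (fun x => ‖k x‖ₑ)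
    (fun n => (measurable_expWeight n).aemeasurable.mul hk.aestronglyMeasurable.enorm)
    (fun n => Eventually.of_forall fun x => ?_) hk.2.ne (Eventually.of_forall fun x => ?_)
  · simpa using h
  · rcases le_or_gt x 0 with hx | hx
    · simp [hk0 x hx]
    · calc expWeight n x * ‖k x‖ₑ ≤ 1 * ‖k x‖ₑ := by
            gcongr; rw [← expWeight_zero n]; exact expWeight_le hx.le
        _ = _ := one_mul _
  · rcases le_or_gt x 0 with hx | hx
    · simp [hk0 x hx]
    · have h1 : Tendsto (fun n : ℕ => Real.exp (-(n * x))) atTop (𝓝 0) :=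
        Real.tendsto_exp_neg_atTop_nhds_zero.comp
          (tendsto_natCast_atTop_atTop.atTop_mul_const hx)
      have h2 : Tendsto (fun n : ℕ => expWeight n x) atTop (𝓝 0) := by
        simpa [expWeight] using ENNReal.tendsto_ofReal h1
      simpa using ENNReal.Tendsto.mul_const h2 (Or.inr enorm_ne_top)

/-- Regularity of solutions of a nonlinear Volterra equation of the second kind
`p = c + k * (R - Φ ∘ p)` on `(0, T)`, with all functions extended by zero. The increment of `p`
satisfies `|Δp| ≤ |k| * (|ΔR| + L |Δp|)` up to `O(δ)` boundary effects, and a large exponential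
weight makes the last term absorbable. -/
theorem translationLipschitz_of_volterra {T : ℝ} (hT : 0 < T) {k : ℝ → ℝ} (hk : Integrable k)
    (hk0 : ∀ t ≤ 0, k t = 0) {p R : ℝ → ℂ} (hpm : AEStronglyMeasurable p)
    (hRm : AEStronglyMeasurable R) {B B' : ℝ} (hpB : ∀ t, ‖p t‖ ≤ B) (hRB : ∀ t, ‖R t‖ ≤ B')
    (hp0 : ∀ t ∉ Ioo 0 T, p t = 0) (hR0 : ∀ t ∉ Ioo 0 T, R t = 0) {Φ : ℂ → ℂ}
    (hΦc : Continuous Φ) (hΦ0 : Φ 0 = 0) {L : ℝ} (hL : 0 ≤ L)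
    (hΦ : ∀ a b : ℂ, ‖a‖ ≤ B → ‖b‖ ≤ B → ‖Φ a - Φ b‖ ≤ L * ‖a - b‖) {c : ℂ}
    (heq : ∀ t ∈ Ioo 0 T, p t = c + (k ⋆ fun s => R s - Φ (p s)) t)
    (hR : TranslationLipschitz R) : TranslationLipschitz fun s => R s - Φ (p s) := by
  obtain ⟨C, hC, r, hr, hRδ⟩ := hR
  set w : ℝ → ℂ := fun s => R s - Φ (p s) with hw
  have hB0 : 0 ≤ B := (norm_nonneg _).trans (hpB 0)
  have hwm : AEStronglyMeasurable w := hRm.sub (hΦc.comp_aestronglyMeasurable hpm)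
  have hwB : ∀ t, ‖w t‖ ≤ B' + L * B := by
    intro t
    refine (norm_sub_le _ _).trans (add_le_add (hRB t) ?_)
    have := hΦ (p t) 0 (hpB t) (by simpa using hB0)
    rw [hΦ0, sub_zero, sub_zero] at this
    exact this.trans (by gcongr; exact hpB t)
  have hpi := integrable_of_bounded_support hpm hpB hp0
  have hlim : Tendsto (fun n => (∫⁻ x, expWeight n x * ‖k x‖ₑ) * ENNReal.ofReal L) atTop
      (𝓝 0) := by
    simpa using ENNReal.Tendsto.mul_const (tendsto_lintegral_expWeight_mul hk hk0)
      (Or.inr ENNReal.ofReal_ne_top)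
  -- a weight steep enough that the nonlinear term is at most half the left-hand side
  obtain ⟨n, hn⟩ := (hlim.eventually_lt_const (show (0 : ℝ≥0∞) < 2⁻¹ by simp)).exists
  set K : ℝ≥0∞ := ∫⁻ x, expWeight n x * ‖k x‖ₑ with hK
  have hKtop : K ≠ ⊤ := by
    refine ne_top_of_le_ne_top hk.2.ne (lintegral_mono fun x => ?_)
    rcases le_or_gt x 0 with hx | hx
    · simp [hk0 x hx]
    · calc expWeight n x * ‖k x‖ₑ ≤ 1 * ‖k x‖ₑ := by
            gcongr; rw [← expWeight_zero n]; exact expWeight_le hx.le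
        _ = _ := one_mul _
  set E : ℝ≥0∞ := expWeight n (-T) with hE
  have hEtop : E ≠ ⊤ := ENNReal.ofReal_ne_top
  have hEmul : E * expWeight n T = 1 := by
    rw [hE, ← expWeight_add, neg_add_cancel, expWeight_zero]
  set A : ℝ≥0∞ := 2 * (K * (E * C) + E * (2 * ENNReal.ofReal (2 * B))) with hA
  have hAtop : A ≠ ⊤ := by rw [hA]; finiteness
  refine ⟨C + ENNReal.ofReal L * (E * A), by finiteness, min r T, lt_min hr hT, fun δ hδ => ?_⟩
  have hδ0 := hδ.1
  have hδT : δ < T := hδ.2.trans_le (min_le_right _ _)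
  have hRδ' := hRδ δ ⟨hδ0, hδ.2.trans_le (min_le_left _ _)⟩
  -- increments vanish outside `[-T, T]`, on which the weight is comparable to `1`
  have hvan : ∀ u : ℝ → ℂ, (∀ t ∉ Ioo 0 T, u t = 0) → ∀ x, x ∉ Icc (-T) T →
      u (x + δ) - u x = 0 := by
    intro u hu x hx
    rw [hu, hu, sub_zero]
    · exact fun h => hx ⟨by linarith [h.1], h.2.le⟩
    · exact fun h => hx ⟨by linarith [h.1], by linarith [h.2]⟩
  have hweight_le : ∀ u : ℝ → ℂ, (∀ t ∉ Ioo 0 T, u t = 0) →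
      ∫⁻ x, expWeight n x * ‖u (x + δ) - u x‖ₑ ≤ E * ∫⁻ x, ‖u (x + δ) - u x‖ₑ := by
    intro u hu
    rw [← lintegral_const_mul' _ _ hEtop]
    refine lintegral_mono fun x => ?_
    by_cases hx : x ∈ Icc (-T) T
    · gcongr; exact expWeight_le hx.1
    · simp [hvan u hu x hx]
  have hle_weight : ∫⁻ x, ‖p (x + δ) - p x‖ₑ
      ≤ E * ∫⁻ x, expWeight n x * ‖p (x + δ) - p x‖ₑ := by
    rw [← lintegral_const_mul' _ _ hEtop]
    refine lintegral_mono fun x => ?_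
    by_cases hx : x ∈ Icc (-T) T
    · rw [← mul_assoc]
      calc ‖p (x + δ) - p x‖ₑ = (E * expWeight n T) * ‖p (x + δ) - p x‖ₑ := by
            rw [hEmul, one_mul]
        _ ≤ _ := by gcongr; exact expWeight_le hx.2
    · simp [hvan p hp0 x hx]
  have hwpt : ∀ x, ‖w (x + δ) - w x‖ₑ
      ≤ ‖R (x + δ) - R x‖ₑ + ENNReal.ofReal L * ‖p (x + δ) - p x‖ₑ := by
    intro x
    have e : w (x + δ) - w x = (R (x + δ) - R x) - (Φ (p (x + δ)) - Φ (p x)) := by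
      simp only [hw]; ring
    rw [e]
    refine enorm_sub_le.trans (add_le_add le_rfl ?_)
    rw [← ofReal_norm (p (x + δ) - p x), ← ENNReal.ofReal_mul hL]
    exact enorm_le_ofReal (hΦ _ _ (hpB _) (hpB _))
  have hshift : ∀ {u : ℝ → ℂ}, AEStronglyMeasurable u →
      AEStronglyMeasurable fun x => u (x + δ) - u x := fun hu =>
    (hu.comp_quasiMeasurePreserving
      (measurePreserving_add_right volume δ).quasiMeasurePreserving).sub hu
  have hconv : ∀ x, (k ⋆ w) (x + δ) - (k ⋆ w) x = (k ⋆ fun y => w (y + δ) - w y) x := by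
    have hex : ∀ u : ℝ → ℂ, AEStronglyMeasurable u → (∀ t, ‖u t‖ ≤ B' + L * B) → ∀ x,
        Integrable fun t => k t • u (x - t) := by
      intro u hum huB x
      exact hk.smul_bdd (B' + L * B) (hum.comp_quasiMeasurePreserving
        (quasiMeasurePreserving_sub_left_of_right_invariant volume x))
        (Eventually.of_forall fun t => huB _)
    intro x
    rw [← convolution_comp_add_right]
    simp only [convolution_lsmul, smul_sub]
    rw [integral_sub]
    · exact hex (fun y => w (y + δ)) (hwm.comp_quasiMeasurePreserving
        (measurePreserving_add_right volume δ).quasiMeasurePreserving) (fun t => hwB _) x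
    · exact hex w hwm hwB x
  set N : ℝ≥0∞ := ∫⁻ x, expWeight n x * ‖p (x + δ) - p x‖ₑ with hN
  have hNtop : N ≠ ⊤ :=
    ne_top_of_le_ne_top (ENNReal.mul_ne_top hEtop ((hpi.comp_add_right δ).sub hpi).2.ne)
      (hweight_le p hp0)
  have hppt : ∀ x, expWeight n x * ‖p (x + δ) - p x‖ₑ
      ≤ expWeight n x * ‖(k ⋆ fun y => w (y + δ) - w y) x‖ₑ
        + E * (endpointStrip T δ).indicator (fun _ => ENNReal.ofReal (2 * B)) x := by
    intro x
    by_cases hx : x ∈ endpointStrip T δ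
    · refine le_add_left ?_
      rw [indicator_of_mem hx]
      refine mul_le_mul' (expWeight_le ?_)
        (enorm_le_ofReal ((norm_sub_le _ _).trans (by linarith [hpB x, hpB (x + δ)])))
      rcases hx with h | h <;> linarith [h.1]
    · refine le_add_right ?_
      gcongr
      rcases mem_or_notMem_of_notMem_endpointStrip hδ0 hx with h | h
      · rw [heq x ⟨h.1, by linarith⟩, heq (x + δ) ⟨by linarith [h.1], by linarith [h.2]⟩,
          ← hconv x, add_sub_add_left_eq_sub]
      · rw [hp0 _ h.1, hp0 _ h.2]; simp
  have hmain : N ≤ K * (E * (C * ENNReal.ofReal δ) + ENNReal.ofReal L * N)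
      + E * (2 * ENNReal.ofReal (2 * B) * ENNReal.ofReal δ) := by
    calc N ≤ ∫⁻ x, (expWeight n x * ‖(k ⋆ fun y => w (y + δ) - w y) x‖ₑ
          + E * (endpointStrip T δ).indicator (fun _ => ENNReal.ofReal (2 * B)) x) :=
          lintegral_mono hppt
      _ = (∫⁻ x, expWeight n x * ‖(k ⋆ fun y => w (y + δ) - w y) x‖ₑ)
          + E * ∫⁻ x, (endpointStrip T δ).indicator (fun _ => ENNReal.ofReal (2 * B)) x := by
          rw [lintegral_add_right _ ((measurable_const.indicator
            (measurableSet_endpointStrip T δ)).const_mul _), lintegral_const_mul' _ _ hEtop]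
      _ ≤ K * (∫⁻ x, expWeight n x * ‖w (x + δ) - w x‖ₑ)
          + E * (2 * ENNReal.ofReal (2 * B) * ENNReal.ofReal δ) := by
          gcongr
          · exact lintegral_mul_enorm_convolution_le (measurable_expWeight n) (expWeight_add n)
              hk.aestronglyMeasurable (hshift hwm)
          · exact lintegral_indicator_endpointStrip_le T δ _
      _ ≤ _ := by
          gcongr
          calc ∫⁻ x, expWeight n x * ‖w (x + δ) - w x‖ₑ
              ≤ ∫⁻ x, (expWeight n x * ‖R (x + δ) - R x‖ₑ
                + ENNReal.ofReal L * (expWeight n x * ‖p (x + δ) - p x‖ₑ)) := by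
                refine lintegral_mono fun x => ?_
                calc _ ≤ expWeight n x * (‖R (x + δ) - R x‖ₑ
                      + ENNReal.ofReal L * ‖p (x + δ) - p x‖ₑ) := by gcongr; exact hwpt x
                  _ = _ := by ring
            _ = (∫⁻ x, expWeight n x * ‖R (x + δ) - R x‖ₑ) + ENNReal.ofReal L * N := by
                have hm : AEMeasurable fun x => expWeight n x * ‖R (x + δ) - R x‖ₑ :=
                  (measurable_expWeight n).aemeasurable.mul (hshift hRm).enorm
                rw [lintegral_add_left' hm, lintegral_const_mul' _ _ ENNReal.ofReal_ne_top]
            _ ≤ _ := by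
                gcongr
                exact (hweight_le R hR0).trans (by gcongr)
  have hNle : N ≤ A * ENNReal.ofReal δ := by
    have h1 : N ≤ 2⁻¹ * (A * ENNReal.ofReal δ) + 2⁻¹ * N := by
      calc N ≤ _ := hmain
        _ = (K * (E * C) + E * (2 * ENNReal.ofReal (2 * B))) * ENNReal.ofReal δ
            + (K * ENNReal.ofReal L) * N := by ring
        _ ≤ (K * (E * C) + E * (2 * ENNReal.ofReal (2 * B))) * ENNReal.ofReal δ + 2⁻¹ * N := by
            gcongr
        _ = _ := by
            rw [hA, mul_assoc 2, ← mul_assoc 2⁻¹ 2, ENNReal.inv_mul_cancel (by simp) (by simp),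
              one_mul]
    have h2 : 2⁻¹ * N + 2⁻¹ * N ≤ 2⁻¹ * (A * ENNReal.ofReal δ) + 2⁻¹ * N := by
      rwa [← add_mul, ENNReal.inv_two_add_inv_two, one_mul]
    have h3 := (ENNReal.add_le_add_iff_right (by finiteness)).1 h2
    exact (ENNReal.mul_le_mul_iff_right (by simp) (by simp)).1 h3
  calc ∫⁻ x, ‖w (x + δ) - w x‖ₑ
      ≤ ∫⁻ x, (‖R (x + δ) - R x‖ₑ + ENNReal.ofReal L * ‖p (x + δ) - p x‖ₑ) := lintegral_mono hwpt
    _ = (∫⁻ x, ‖R (x + δ) - R x‖ₑ) + ENNReal.ofReal L * ∫⁻ x, ‖p (x + δ) - p x‖ₑ := by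
        rw [lintegral_add_left' (hshift hRm).enorm, lintegral_const_mul' _ _ ENNReal.ofReal_ne_top]
    _ ≤ C * ENNReal.ofReal δ + ENNReal.ofReal L * (E * (A * ENNReal.ofReal δ)) := by
        gcongr
        exact hle_weight.trans (by gcongr)
    _ = _ := by ring

/-! ### Free evolution of Schwartz functions at the origin -/

lemma re_inv_pos {z : ℂ} (hz : 0 < z.re) : 0 < (z⁻¹).re := by
  rw [Complex.inv_re]
  refine div_pos hz (Complex.normSq_pos.2 fun h => ?_)
  simp [h] at hz

lemma norm_cexp_neg_mul_sq_le {b : ℂ} (hb : 0 ≤ b.re) (r : ℝ) :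
    ‖Complex.exp (-b * (r : ℂ) ^ 2)‖ ≤ 1 := by
  rw [Complex.norm_exp, Real.exp_le_one_iff]
  have : (-b * (r : ℂ) ^ 2).re = -(b.re * r ^ 2) := by
    rw [← Complex.ofReal_pow, Complex.re_mul_ofReal]; simp
  rw [this]
  have := mul_nonneg hb (sq_nonneg r)
  linarith

lemma integral_plane_cexp_neg_mul_sq {b : ℂ} (hb : 0 < b.re) :
    ∫ y : Plane, Complex.exp (-b * (‖y‖ : ℂ) ^ 2) = Real.pi / b := by
  rw [GaussianFourier.integral_cexp_neg_mul_sq_norm hb]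
  simp

/-- Heat semigroup with complex time `z`, `Re z > 0`, at the origin: physical and frequency side. -/
lemma integral_gaussian_mul_schwartz (φ : 𝓢(Plane, ℂ)) {z : ℂ} (hz : 0 < z.re) :
    ∫ y : Plane, Complex.exp (-(4 * z)⁻¹ * (‖y‖ : ℂ) ^ 2) * φ y
      = 4 * Real.pi * z * ∫ k : Plane, Complex.exp (-(4 * Real.pi ^ 2 * z) * (‖k‖ : ℂ) ^ 2)
        * (𝓕⁻ φ) k := by
  have hb : 0 < ((4 * z)⁻¹).re := re_inv_pos (by simpa using hz)
  have hg : Integrable fun y : Plane => Complex.exp (-(4 * z)⁻¹ * (‖y‖ : ℂ) ^ 2) := by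
    simpa using GaussianFourier.integrable_cexp_neg_mul_sq_norm_add (V := Plane) hb 0 0
  have h := VectorFourier.integral_bilin_fourierIntegral_eq_flip (ContinuousLinearMap.mul ℂ ℂ)
    (L := innerₗ Plane) Real.continuous_fourierChar continuous_inner hg
    ((𝓕⁻ φ).integrable (μ := volume))
  have h' : ∫ k : Plane, 𝓕 (fun y : Plane => Complex.exp (-(4 * z)⁻¹ * (‖y‖ : ℂ) ^ 2)) k
      * (𝓕⁻ φ) k = ∫ y : Plane, Complex.exp (-(4 * z)⁻¹ * (‖y‖ : ℂ) ^ 2)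
        * 𝓕 (⇑(𝓕⁻ φ : 𝓢(Plane, ℂ))) y := by
    rw [flip_innerₗ] at h
    exact h
  rw [← SchwartzMap.fourier_coe, FourierTransform.fourier_fourierInv_eq] at h'
  rw [← h', ← integral_const_mul]
  refine integral_congr_ae (Eventually.of_forall fun k => ?_)
  simp only
  have hz0 : z ≠ 0 := fun h0 => by simp [h0] at hz
  rw [fourier_gaussian_innerProductSpace hb]
  simp only [finrank_euclideanSpace, Fintype.card_fin, Nat.cast_ofNat]
  rw [show ((2 : ℂ) / 2) = 1 by norm_num, Complex.cpow_one, div_inv_eq_mul, div_inv_eq_mul,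
    show -(Real.pi : ℂ) ^ 2 * (‖k‖ : ℂ) ^ 2 * (4 * z)
      = -(4 * Real.pi ^ 2 * z) * (‖k‖ : ℂ) ^ 2 by ring]
  ring

/-- The free evolution of a Schwartz function at the origin, on the frequency side: the limit of
complex heat semigroups as the time tends to the imaginary axis. -/
lemma freeEvolution_schwartz (φ : 𝓢(Plane, ℂ)) {t : ℝ} (ht : 0 < t) :
    freeEvolution t φ 0 = ∫ k : Plane, Complex.exp (-(4 * Real.pi ^ 2 * (Complex.I * t))
      * (‖k‖ : ℂ) ^ 2) * (𝓕⁻ φ) k := by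
  have hz : ∀ n : ℕ, 0 < (((1 / ((n : ℝ) + 1) : ℝ) : ℂ) + Complex.I * t).re := by
    intro n
    have : (0 : ℝ) < 1 / ((n : ℝ) + 1) := by positivity
    rw [Complex.add_re, Complex.ofReal_re]
    simpa using add_pos_of_pos_of_nonneg (Nat.cast_add_one_pos (α := ℝ) n) le_rfl
  have hzlim : Tendsto (fun n : ℕ => ((1 / ((n : ℝ) + 1) : ℝ) : ℂ) + Complex.I * t) atTop
      (𝓝 (Complex.I * t)) := by
    have := (Complex.continuous_ofReal.tendsto 0).comp
      (tendsto_one_div_add_atTop_nhds_zero_nat (𝕜 := ℝ))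
    simpa using this.add_const (Complex.I * (t : ℂ))
  have hne : Complex.I * (t : ℂ) ≠ 0 := by simp [ht.ne']
  have hgen : ∀ (b : ℕ → ℂ) (b₀ : ℂ) (f : 𝓢(Plane, ℂ)), (∀ n, 0 ≤ (b n).re) →
      Tendsto b atTop (𝓝 b₀) →
      Tendsto (fun n => ∫ y : Plane, Complex.exp (-b n * (‖y‖ : ℂ) ^ 2) * f y) atTop
        (𝓝 (∫ y : Plane, Complex.exp (-b₀ * (‖y‖ : ℂ) ^ 2) * f y)) := by
    intro b b₀ f hb hlim
    refine tendsto_integral_of_dominated_convergence (fun y => ‖f y‖) (fun n => ?_)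
      f.integrable.norm (fun n => Eventually.of_forall fun y => ?_)
      (Eventually.of_forall fun y => ?_)
    · exact (Continuous.mul (by fun_prop) f.continuous).aestronglyMeasurable
    · rw [norm_mul]
      exact mul_le_of_le_one_left (norm_nonneg _) (norm_cexp_neg_mul_sq_le (hb n) _)
    · exact ((Complex.continuous_exp.tendsto _).comp (hlim.neg.mul_const _)).mul_const _
  have hl := hgen (fun n => (4 * (((1 / ((n : ℝ) + 1) : ℝ) : ℂ) + Complex.I * t))⁻¹)
    (4 * (Complex.I * t))⁻¹ φ (fun n => (re_inv_pos (by simpa using hz n)).le)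
    ((hzlim.const_mul 4).inv₀ (by simpa using ht.ne'))
  have hr := hgen (fun n => 4 * Real.pi ^ 2 * (((1 / ((n : ℝ) + 1) : ℝ) : ℂ) + Complex.I * t))
    (4 * Real.pi ^ 2 * (Complex.I * t)) (𝓕⁻ φ) (fun n => ?_) (hzlim.const_mul _)
  · have heq := tendsto_nhds_unique
      (hl.congr fun n => integral_gaussian_mul_schwartz φ (hz n)) ((hzlim.const_mul _).mul hr)
    have hk : ∀ y : Plane, freeKernel t ‖(0 : Plane) - y‖ * φ y
        = (2 * Complex.I * t)⁻¹ * (Complex.exp (-(4 * (Complex.I * t))⁻¹ * (‖y‖ : ℂ) ^ 2) * φ y) := by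
      intro y
      rw [freeKernel, zero_sub, norm_neg, div_eq_inv_mul _ (2 * Complex.I * (t : ℂ)), mul_assoc]
      congr 3
      rw [div_eq_mul_inv, ← mul_assoc]; ring
    rw [freeEvolution]
    simp_rw [hk]
    rw [integral_const_mul, heq]
    have hpi : (Real.pi : ℂ) ≠ 0 := by exact_mod_cast Real.pi_ne_zero
    have ht' : (t : ℂ) ≠ 0 := by exact_mod_cast ht.ne'
    field_simp
    ring_nf
  · have := hz n
    have e : (4 * (Real.pi : ℂ) ^ 2) = ((4 * Real.pi ^ 2 : ℝ) : ℂ) := by push_cast; ring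
    rw [e, Complex.re_ofReal_mul]
    positivity

/-- The free evolution of a Schwartz function at the origin is Lipschitz in time. -/
lemma exists_lipschitz_freeEvolution_schwartz (φ : 𝓢(Plane, ℂ)) :
    ∃ C : ℝ, 0 ≤ C ∧ ∀ s t : ℝ, 0 < s → s ≤ t →
      ‖freeEvolution t φ 0 - freeEvolution s φ 0‖ ≤ C * (t - s) := by
  refine ⟨4 * Real.pi ^ 2 * ∫ k : Plane, ‖k‖ ^ 2 * ‖(𝓕⁻ φ) k‖, by positivity,
    fun s t hs hst => ?_⟩
  have hint : ∀ r : ℝ, Integrable fun k : Plane =>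
      Complex.exp (-(4 * Real.pi ^ 2 * (Complex.I * r)) * (‖k‖ : ℂ) ^ 2) * (𝓕⁻ φ) k := by
    intro r
    refine (𝓕⁻ φ).integrable.bdd_mul (c := 1)
      (Continuous.aestronglyMeasurable (by fun_prop)) (Eventually.of_forall fun k => ?_)
    refine norm_cexp_neg_mul_sq_le (le_of_eq ?_) _
    have e : (4 * (Real.pi : ℂ) ^ 2) = ((4 * Real.pi ^ 2 : ℝ) : ℂ) := by push_cast; ring
    rw [e, Complex.re_ofReal_mul]; simp
  rw [freeEvolution_schwartz φ (hs.trans_le hst), freeEvolution_schwartz φ hs,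
    ← integral_sub (hint t) (hint s)]
  have hb := (𝓕⁻ φ).integrable_pow_mul volume 2
  calc _ ≤ ∫ k : Plane, (4 * Real.pi ^ 2 * (t - s)) * (‖k‖ ^ 2 * ‖(𝓕⁻ φ) k‖) := by
        refine norm_integral_le_of_norm_le (hb.const_mul _) (Eventually.of_forall fun k => ?_)
        rw [← sub_mul, norm_mul, ← mul_assoc (4 * Real.pi ^ 2 * (t - s))]
        gcongr ?_ * _
        have e : ∀ r : ℝ, -(4 * Real.pi ^ 2 * (Complex.I * r)) * (‖k‖ : ℂ) ^ 2
            = Complex.I * ((-(4 * Real.pi ^ 2 * r * ‖k‖ ^ 2) : ℝ) : ℂ) := by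
          intro r; push_cast; ring
        rw [e, e]
        have e2 : Complex.I * ((-(4 * Real.pi ^ 2 * t * ‖k‖ ^ 2) : ℝ) : ℂ)
            = Complex.I * ((-(4 * Real.pi ^ 2 * s * ‖k‖ ^ 2) : ℝ) : ℂ)
              + Complex.I * ((-(4 * Real.pi ^ 2 * (t - s) * ‖k‖ ^ 2) : ℝ) : ℂ) := by
          push_cast; ring
        rw [e2, Complex.exp_add]
        calc _ = ‖Complex.exp (Complex.I * ((-(4 * Real.pi ^ 2 * s * ‖k‖ ^ 2) : ℝ) : ℂ))
              * (Complex.exp (Complex.I * ((-(4 * Real.pi ^ 2 * (t - s) * ‖k‖ ^ 2) : ℝ) : ℂ)) - 1)‖ := by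
                congr 1; ring
          _ ≤ 1 * ‖-(4 * Real.pi ^ 2 * (t - s) * ‖k‖ ^ 2)‖ := by
              rw [norm_mul]
              gcongr
              · rw [mul_comm, Complex.norm_exp_ofReal_mul_I]
              · exact Real.norm_exp_I_mul_ofReal_sub_one_le
          _ = _ := by
              have := sub_nonneg.2 hst
              rw [one_mul, norm_neg, Real.norm_of_nonneg (by positivity)]
    _ = _ := by rw [integral_const_mul]; ring

/-! ### Free evolution of the Green function at the origin -/

/-- The Green function as a superposition of heat kernels,
`G_lam(x) = ∫₀^∞ e^{-lam s} e^{-|x|²/4s} / (4πs) ds`, by the substitution `s = c e^u` with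
`c = |x| / (2 √lam)`. -/
lemma green_eq_integral {lam : ℝ} (hlam : 0 < lam) {x : Plane} (hx : x ≠ 0) :
    green lam x = ∫ s in Ioi (0 : ℝ),
      Real.exp (-(lam * s)) * Real.exp (-(‖x‖ ^ 2 / (4 * s))) / (4 * Real.pi * s) := by
  have hr : 0 < ‖x‖ := norm_pos_iff.2 hx
  have hl : 0 < Real.sqrt lam := Real.sqrt_pos.2 hlam
  set c : ℝ := ‖x‖ / (2 * Real.sqrt lam) with hc
  have hc0 : 0 < c := by positivity
  have himg : (fun u : ℝ => c * Real.exp u) '' univ = Ioi 0 := by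
    ext s
    simp only [image_univ, mem_range, mem_Ioi]
    constructor
    · rintro ⟨u, rfl⟩; positivity
    · intro hs
      exact ⟨Real.log (s / c), by rw [Real.exp_log (by positivity)]; field_simp⟩
  have hinj : InjOn (fun u : ℝ => c * Real.exp u) univ := fun u _ v _ h =>
    Real.exp_injective (mul_left_cancel₀ hc0.ne' h)
  rw [← himg, integral_image_eq_integral_abs_deriv_smul MeasurableSet.univ
    (fun u _ => ((Real.hasDerivAt_exp u).const_mul c).hasDerivWithinAt) hinj]
  have habs := integral_comp_abs
    (f := fun u => Real.exp (-(Real.sqrt lam * ‖x‖ * Real.cosh u)))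
  simp only [Real.cosh_abs] at habs
  rw [green, macdonaldZero, setIntegral_univ]
  have e : ∀ u : ℝ, |c * Real.exp u| • (Real.exp (-(lam * (c * Real.exp u)))
      * Real.exp (-(‖x‖ ^ 2 / (4 * (c * Real.exp u)))) / (4 * Real.pi * (c * Real.exp u)))
      = (4 * Real.pi)⁻¹ * Real.exp (-(Real.sqrt lam * ‖x‖ * Real.cosh u)) := by
    intro u
    have h0 : 0 < c * Real.exp u := by positivity
    rw [abs_of_pos h0, smul_eq_mul, ← Real.exp_add]
    have h1 : -(lam * (c * Real.exp u)) + -(‖x‖ ^ 2 / (4 * (c * Real.exp u)))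
        = -(Real.sqrt lam * ‖x‖ * Real.cosh u) := by
      rw [Real.cosh_eq, Real.exp_neg, hc]
      nth_rewrite 1 [← Real.mul_self_sqrt hlam.le]
      have := (Real.exp_pos u).ne'
      field_simp
      ring
    rw [h1]
    field_simp
  simp_rw [e]
  rw [integral_const_mul, habs]
  field_simp
  ring

lemma norm_freeKernel {t : ℝ} (ht : 0 < t) (r : ℝ) : ‖freeKernel t r‖ = (2 * t)⁻¹ := by
  have e : -((r : ℂ) ^ 2 / (4 * Complex.I * (t : ℂ))) = ((r ^ 2 / (4 * t) : ℝ) : ℂ) * Complex.I := by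
    have ht' : (t : ℂ) ≠ 0 := by exact_mod_cast ht.ne'
    push_cast
    field_simp
    rw [Complex.I_sq]; ring
  rw [freeKernel, norm_div, e, Complex.norm_exp_ofReal_mul_I]
  simp [abs_of_pos ht]

lemma continuous_freeKernel_norm (t : ℝ) : Continuous fun y : Plane => freeKernel t ‖0 - y‖ := by
  unfold freeKernel
  simp only [div_eq_mul_inv]
  fun_prop

/-- The integrand of `U₀(t) G_lam (0)` in physical space `y` and heat time `s`. -/
noncomputable def greenIntegrand (lam t : ℝ) (y : Plane) (s : ℝ) : ℂ :=
  freeKernel t ‖0 - y‖ *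
    ((Real.exp (-(lam * s)) * Real.exp (-(‖y‖ ^ 2 / (4 * s))) / (4 * Real.pi * s) : ℝ) : ℂ)

lemma integrable_heatKernel {s : ℝ} (hs : 0 < s) :
    Integrable fun y : Plane => Real.exp (-(‖y‖ ^ 2 / (4 * s))) := by
  have hb : 0 < (((4 * s)⁻¹ : ℝ) : ℂ).re := by rw [Complex.ofReal_re]; positivity
  have := (GaussianFourier.integrable_cexp_neg_mul_sq_norm_add (V := Plane) hb 0 0).norm
  refine this.congr (Eventually.of_forall fun y => ?_)
  simp only [inner_zero_left, Complex.ofReal_zero, mul_zero, add_zero]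
  rw [show -(((4 * s)⁻¹ : ℝ) : ℂ) * (‖y‖ : ℂ) ^ 2 = ((-(‖y‖ ^ 2 / (4 * s)) : ℝ) : ℂ) by
    push_cast; rw [div_eq_mul_inv]; ring, Complex.norm_exp_ofReal]

lemma integral_heatKernel {s : ℝ} (hs : 0 < s) :
    ∫ y : Plane, Real.exp (-(‖y‖ ^ 2 / (4 * s))) = 4 * Real.pi * s := by
  have h := GaussianFourier.integral_rexp_neg_mul_sq_norm (V := Plane)
    (b := (4 * s)⁻¹) (by positivity)
  simp only [finrank_euclideanSpace, Fintype.card_fin, Nat.cast_ofNat] at h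
  rw [div_self (two_ne_zero), Real.rpow_one, div_inv_eq_mul] at h
  rw [show 4 * Real.pi * s = Real.pi * (4 * s) by ring, ← h]
  congr 1; ext y; congr 1; rw [div_eq_mul_inv]; ring

lemma integrable_greenIntegrand {lam t : ℝ} (hlam : 0 < lam) (ht : 0 < t) :
    Integrable (fun p : Plane × ℝ => greenIntegrand lam t p.1 p.2)
      (volume.prod (volume.restrict (Ioi 0))) := by
  have hm : Measurable fun p : Plane × ℝ => greenIntegrand lam t p.1 p.2 := by
    unfold greenIntegrand
    refine ((continuous_freeKernel_norm t).measurable.comp measurable_fst).mul ?_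
    refine Complex.measurable_ofReal.comp ?_
    fun_prop
  have hnorm : ∀ s > 0, ∀ y : Plane, ‖greenIntegrand lam t y s‖
      = (2 * t)⁻¹ * (Real.exp (-(lam * s)) / (4 * Real.pi * s))
        * Real.exp (-(‖y‖ ^ 2 / (4 * s))) := by
    intro s hs y
    rw [greenIntegrand, norm_mul, norm_freeKernel ht, Complex.norm_real,
      Real.norm_of_nonneg (by positivity)]
    ring
  refine (integrable_prod_iff' hm.aestronglyMeasurable).2 ⟨?_, ?_⟩
  · filter_upwards [ae_restrict_mem measurableSet_Ioi] with s hs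
    have hs' : 0 < s := hs
    refine (integrable_norm_iff ?_).1 ?_
    · exact (hm.comp (measurable_id.prodMk measurable_const)).aestronglyMeasurable
    · simp_rw [hnorm s hs']
      exact (integrable_heatKernel hs').const_mul _
  · have h1 : IntegrableOn (fun s => (2 * t)⁻¹ * Real.exp (-lam * s)) (Ioi 0) :=
      (integrableOn_exp_mul_Ioi (by linarith) 0).const_mul _
    refine h1.congr_fun (fun s hs => ?_) measurableSet_Ioi
    have hs' : 0 < s := hs
    simp only
    simp_rw [hnorm s hs']
    rw [integral_const_mul, integral_heatKernel hs', neg_mul]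
    field_simp

lemma integral_greenIntegrand {lam t s : ℝ} (ht : 0 < t) (hs : 0 < s) :
    ∫ y : Plane, greenIntegrand lam t y s
      = 2⁻¹ * ((Real.exp (-(lam * s)) : ℂ) / (s + Complex.I * t)) := by
  have ht' : (t : ℂ) ≠ 0 := by exact_mod_cast ht.ne'
  have hs' : (s : ℂ) ≠ 0 := by exact_mod_cast hs.ne'
  have hpi : (Real.pi : ℂ) ≠ 0 := by exact_mod_cast Real.pi_ne_zero
  have hst : (s : ℂ) + Complex.I * t ≠ 0 := by
    intro h
    have := congrArg Complex.re h
    simp at this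
    exact hs.ne' this
  set b : ℂ := (4 * s : ℂ)⁻¹ + (4 * Complex.I * t)⁻¹ with hb
  have hbre : 0 < b.re := by
    have e1 : (4 * s : ℂ)⁻¹ = (((4 * s)⁻¹ : ℝ) : ℂ) := by push_cast; rfl
    have e2 : (4 * Complex.I * t)⁻¹ = -Complex.I * (((4 * t)⁻¹ : ℝ) : ℂ) := by
      push_cast
      rw [mul_inv, mul_inv, Complex.inv_I]; ring
    rw [hb, e1, e2, Complex.add_re, Complex.ofReal_re, Complex.re_mul_ofReal]
    simp [hs]
  have e : ∀ y : Plane, greenIntegrand lam t y s = ((Real.exp (-(lam * s)) : ℂ)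
      / (4 * Real.pi * s * (2 * Complex.I * t))) * Complex.exp (-b * (‖y‖ : ℂ) ^ 2) := by
    intro y
    have e1 : -b * (‖y‖ : ℂ) ^ 2 = -((‖y‖ : ℂ) ^ 2 / (4 * Complex.I * t))
        + ((-(‖y‖ ^ 2 / (4 * s)) : ℝ) : ℂ) := by
      rw [hb]; push_cast; rw [div_eq_mul_inv, div_eq_mul_inv]; ring
    rw [greenIntegrand, freeKernel, zero_sub, norm_neg, e1, Complex.exp_add]
    push_cast
    field_simp
  simp_rw [e]
  rw [integral_const_mul, integral_plane_cexp_neg_mul_sq hbre]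
  have hb' : b = (s + Complex.I * t) / (4 * s * (Complex.I * t)) := by
    rw [hb]; field_simp; ring
  rw [hb']
  field_simp

/-- The Stieltjes-type integral `∫₀^∞ e^{-lam s} / (s + i t) ds`, which is `4π U₀(t) G_lam (0)`. -/
noncomputable def greenTrace (lam t : ℝ) : ℂ :=
  ∫ s in Ioi (0 : ℝ), (Real.exp (-(lam * s)) : ℂ) / (s + Complex.I * t)

lemma freeKernel_mul_green_ae {lam : ℝ} (hlam : 0 < lam) (t : ℝ) :
    (fun y : Plane => freeKernel t ‖0 - y‖ * (green lam y : ℂ))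
      =ᵐ[volume] fun y => ∫ s in Ioi (0 : ℝ), greenIntegrand lam t y s := by
  filter_upwards [Measure.ae_ne volume (0 : Plane)] with y hy
  rw [green_eq_integral hlam hy, ← integral_complex_ofReal, ← integral_const_mul]
  rfl

lemma integrable_freeKernel_mul_green {lam t : ℝ} (hlam : 0 < lam) (ht : 0 < t) :
    Integrable fun y : Plane => freeKernel t ‖0 - y‖ * (green lam y : ℂ) :=
  (integrable_greenIntegrand hlam ht).integral_prod_left.congr (freeKernel_mul_green_ae hlam t).symm

lemma integral_freeKernel_mul_green {lam t : ℝ} (hlam : 0 < lam) (ht : 0 < t) :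
    ∫ y : Plane, freeKernel t ‖0 - y‖ * (green lam y : ℂ) = 2⁻¹ * greenTrace lam t := by
  rw [integral_congr_ae (freeKernel_mul_green_ae hlam t),
    integral_integral_swap (integrable_greenIntegrand hlam ht), greenTrace, ← integral_const_mul]
  exact setIntegral_congr_fun measurableSet_Ioi fun s hs => integral_greenIntegrand ht hs

/-- The trace at the origin of the free evolution of an admissible datum. -/
lemma freeEvolution_schwartzData {lam t : ℝ} (hlam : 0 < lam) (ht : 0 < t) {ψ₀ : Plane → ℂ}
    (φ : 𝓢(Plane, ℂ)) (q₀ : ℂ) (h : ∀ᵐ x : Plane, ψ₀ x = φ x + q₀ * (green lam x : ℂ)) :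
    4 * (Real.pi : ℂ) * freeEvolution t ψ₀ 0
      = 4 * Real.pi * freeEvolution t φ 0 + q₀ * greenTrace lam t := by
  have hφ : Integrable fun y : Plane => freeKernel t ‖0 - y‖ * φ y :=
    φ.integrable.bdd_mul (c := (2 * t)⁻¹) (continuous_freeKernel_norm t).aestronglyMeasurable
      (Eventually.of_forall fun y => (norm_freeKernel ht _).le)
  have e : (fun y : Plane => freeKernel t ‖0 - y‖ * ψ₀ y) =ᵐ[volume] fun y =>
      freeKernel t ‖0 - y‖ * φ y + q₀ * (freeKernel t ‖0 - y‖ * (green lam y : ℂ)) := by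
    filter_upwards [h] with y hy
    rw [hy]; ring
  have hpi : (Real.pi : ℂ) ≠ 0 := by exact_mod_cast Real.pi_ne_zero
  rw [freeEvolution, freeEvolution, integral_congr_ae e, integral_add hφ
    ((integrable_freeKernel_mul_green hlam ht).const_mul _), integral_const_mul,
    integral_freeKernel_mul_green hlam ht]
  field_simp
  ring

/-! ### Regularity of the source -/

lemma add_I_mul_ne_zero {t : ℝ} (ht : t ≠ 0) (s : ℝ) : (s : ℂ) + Complex.I * t ≠ 0 := by
  intro h
  have := congrArg Complex.im h
  simp at this
  exact ht this

lemma abs_le_norm_add_I_mul (s t : ℝ) : |t| ≤ ‖(s : ℂ) + Complex.I * t‖ := by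
  have := Complex.abs_im_le_norm ((s : ℂ) + Complex.I * t)
  simpa using this

/-- The arithmetic-geometric mean bound `|s + it|² = s² + t² ≥ st`. -/
lemma sqrt_mul_sqrt_le_norm_add_I_mul {s t : ℝ} (hs : 0 ≤ s) :
    Real.sqrt s * Real.sqrt t ≤ ‖(s : ℂ) + Complex.I * t‖ := by
  rw [← Real.sqrt_mul hs]
  refine Real.sqrt_le_iff.2 ⟨norm_nonneg _, ?_⟩
  rw [Complex.sq_norm, Complex.normSq_apply]
  simp
  nlinarith [sq_nonneg (s - t), sq_nonneg s, sq_nonneg t]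

lemma continuous_greenTrace_integrand (lam : ℝ) {t : ℝ} (ht : t ≠ 0) :
    Continuous fun s : ℝ => (Real.exp (-(lam * s)) : ℂ) / (s + Complex.I * t) :=
  Continuous.div (by fun_prop) (by fun_prop) (add_I_mul_ne_zero ht)

lemma integrableOn_exp_neg_mul {lam : ℝ} (hlam : 0 < lam) :
    IntegrableOn (fun s : ℝ => Real.exp (-(lam * s))) (Ioi 0) := by
  simpa using integrableOn_exp_mul_Ioi (show -lam < 0 by linarith) 0

lemma integrableOn_greenTrace_integrand {lam t : ℝ} (hlam : 0 < lam) (ht : 0 < t) :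
    IntegrableOn (fun s : ℝ => (Real.exp (-(lam * s)) : ℂ) / (s + Complex.I * t)) (Ioi 0) := by
  refine Integrable.mono' ((integrableOn_exp_neg_mul hlam).mul_const t⁻¹)
    (continuous_greenTrace_integrand lam ht.ne').aestronglyMeasurable
    (Eventually.of_forall fun s => ?_)
  rw [norm_div, Complex.norm_real, Real.norm_of_nonneg (Real.exp_pos _).le, div_eq_mul_inv]
  gcongr
  exact (le_abs_self t).trans (abs_le_norm_add_I_mul s t)

/-- The trace `F(t)` of the evolved Green function is `O(t^{-1/2})`. Near `0` its true size is
logarithmic, but any locally integrable bound suffices to control `F' + 1 / t = i lam F`. -/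
lemma exists_norm_greenTrace_le {lam : ℝ} (hlam : 0 < lam) :
    ∃ C : ℝ, 0 ≤ C ∧ ∀ t : ℝ, 0 < t → ‖greenTrace lam t‖ ≤ C / Real.sqrt t := by
  have hint : IntegrableOn (fun s : ℝ => Real.exp (-(lam * s)) / Real.sqrt s) (Ioi 0) := by
    have h := integrableOn_rpow_mul_exp_neg_mul_rpow (s := -(1 / 2)) (p := 1) (b := lam)
      (by norm_num) one_pos hlam
    refine h.congr_fun (fun s hs => ?_) measurableSet_Ioi
    have hs' : 0 < s := hs
    simp only [Real.rpow_one]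
    rw [Real.sqrt_eq_rpow, Real.rpow_neg hs'.le, neg_mul]
    ring
  refine ⟨∫ s in Ioi (0 : ℝ), Real.exp (-(lam * s)) / Real.sqrt s,
    setIntegral_nonneg measurableSet_Ioi fun s _ => by positivity, fun t ht => ?_⟩
  rw [greenTrace, ← integral_div]
  refine norm_integral_le_of_norm_le (hint.div_const _) ?_
  filter_upwards [ae_restrict_mem measurableSet_Ioi] with s hs
  have hs' : 0 < s := hs
  rw [norm_div, Complex.norm_real, Real.norm_of_nonneg (Real.exp_pos _).le, div_div]
  gcongr
  exact sqrt_mul_sqrt_le_norm_add_I_mul hs'.le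

lemma hasDerivAt_inv_add_I_mul {s t : ℝ} (ht : t ≠ 0) :
    HasDerivAt (fun t : ℝ => ((s : ℂ) + Complex.I * t)⁻¹)
      (-Complex.I / ((s : ℂ) + Complex.I * t) ^ 2) t := by
  have h1 : HasDerivAt (fun t : ℝ => (s : ℂ) + Complex.I * t) (Complex.I * 1) t :=
    (Complex.ofRealCLM.hasDerivAt.const_mul Complex.I).const_add (s : ℂ)
  convert! h1.inv (add_I_mul_ne_zero ht s) using 1
  rw [mul_one]

/-- Integration by parts in `s`. -/
lemma integral_exp_div_sq {lam t : ℝ} (hlam : 0 < lam) (ht : 0 < t)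
    (hint : IntegrableOn (fun s : ℝ => (Real.exp (-(lam * s)) : ℂ)
      * (-Complex.I / ((s : ℂ) + Complex.I * t) ^ 2)) (Ioi 0)) :
    ∫ s in Ioi (0 : ℝ), (Real.exp (-(lam * s)) : ℂ) * (-Complex.I / ((s : ℂ) + Complex.I * t) ^ 2)
      = Complex.I * lam * greenTrace lam t - (t : ℂ)⁻¹ := by
  have hd : ∀ s : ℝ, HasDerivAt
      (fun s : ℝ => Complex.I * ((Real.exp (-(lam * s)) : ℂ) / (s + Complex.I * t)))
      ((Real.exp (-(lam * s)) : ℂ) * (-Complex.I / ((s : ℂ) + Complex.I * t) ^ 2)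
        - Complex.I * lam * ((Real.exp (-(lam * s)) : ℂ) / (s + Complex.I * t))) s := by
    intro s
    have h1 : HasDerivAt (fun s : ℝ => (Real.exp (-(lam * s)) : ℂ))
        ((Real.exp (-(lam * s)) * -(lam * 1) : ℝ) : ℂ) s :=
      (((hasDerivAt_id s).const_mul lam).neg.exp).ofReal_comp
    have h2 : HasDerivAt (fun s : ℝ => (s : ℂ) + Complex.I * t) 1 s :=
      Complex.ofRealCLM.hasDerivAt.add_const _
    have hne := add_I_mul_ne_zero ht.ne' s
    convert! (h1.div h2 hne).const_mul Complex.I using 1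
    push_cast
    field_simp
    ring
  have hlim : Tendsto (fun s : ℝ => Complex.I * ((Real.exp (-(lam * s)) : ℂ)
      / (s + Complex.I * t))) atTop (𝓝 0) := by
    have h0 : Tendsto (fun s : ℝ => Real.exp (-(lam * s)) * t⁻¹) atTop (𝓝 0) := by
      have := Real.tendsto_exp_neg_atTop_nhds_zero.comp (tendsto_id.const_mul_atTop hlam)
      simpa using this.mul_const t⁻¹
    refine squeeze_zero_norm (fun s => ?_) h0
    rw [norm_mul, Complex.norm_I, one_mul, norm_div, Complex.norm_real,
      Real.norm_of_nonneg (Real.exp_pos _).le, div_eq_mul_inv]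
    gcongr
    exact (le_abs_self t).trans (abs_le_norm_add_I_mul s t)
  have hint2 := (integrableOn_greenTrace_integrand hlam ht).const_mul (Complex.I * (lam : ℂ))
  have h := integral_Ioi_of_hasDerivAt_of_tendsto' (fun s _ => hd s) (hint.sub hint2) hlim
  rw [integral_sub hint hint2, integral_const_mul] at h
  have hI : Complex.I * (((Real.exp (-(lam * 0)) : ℝ) : ℂ) / (((0 : ℝ) : ℂ) + Complex.I * t))
      = (t : ℂ)⁻¹ := by
    simp only [mul_zero, neg_zero, Real.exp_zero, Complex.ofReal_one, Complex.ofReal_zero, zero_add,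
      one_div, mul_inv, Complex.inv_I]
    linear_combination -(t : ℂ)⁻¹ * Complex.I_mul_I
  rw [hI] at h
  rw [greenTrace]
  linear_combination h

/-- The differential equation `F' = i lam F - 1 / t` for the trace `F` of the evolved Green
function; the last term is the source of its logarithmic singularity at `t = 0`. -/
lemma hasDerivAt_greenTrace {lam t : ℝ} (hlam : 0 < lam) (ht : 0 < t) :
    HasDerivAt (greenTrace lam) (Complex.I * lam * greenTrace lam t - (t : ℂ)⁻¹) t := by
  have hdom := hasDerivAt_integral_of_dominated_loc_of_deriv_le
    (μ := volume.restrict (Ioi (0 : ℝ)))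
    (F := fun (t s : ℝ) => (Real.exp (-(lam * s)) : ℂ) / (s + Complex.I * t))
    (F' := fun (t s : ℝ) => (Real.exp (-(lam * s)) : ℂ)
      * (-Complex.I / ((s : ℂ) + Complex.I * t) ^ 2))
    (x₀ := t) (s := Ioi (t / 2)) (bound := fun s => Real.exp (-(lam * s)) * (1 / (t / 2) ^ 2))
    (Ioi_mem_nhds (by linarith)) ?_ (integrableOn_greenTrace_integrand hlam ht) ?_ ?_
    ((integrableOn_exp_neg_mul hlam).mul_const _) ?_
  · rw [← integral_exp_div_sq hlam ht hdom.1]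
    exact hdom.2
  · filter_upwards [lt_mem_nhds ht] with r hr
    exact (continuous_greenTrace_integrand lam hr.ne').aestronglyMeasurable
  · refine Continuous.aestronglyMeasurable (Continuous.mul (by fun_prop) ?_)
    exact Continuous.div (by fun_prop) (by fun_prop)
      fun s => pow_ne_zero 2 (add_I_mul_ne_zero ht.ne' s)
  · refine Eventually.of_forall fun s r hr => ?_
    have hr' : t / 2 < r := hr
    rw [norm_mul, Complex.norm_real, Real.norm_of_nonneg (Real.exp_pos _).le, norm_div, norm_neg,
      Complex.norm_I, norm_pow]
    gcongr
    exact hr'.le.trans ((le_abs_self r).trans (abs_le_norm_add_I_mul s r))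
  · refine Eventually.of_forall fun s r hr => ?_
    have hr' : t / 2 < r := hr
    simp only [div_eq_mul_inv (Real.exp (-(lam * s)) : ℂ)]
    exact (hasDerivAt_inv_add_I_mul (by linarith)).const_mul _

/-- Removing the logarithm from the trace of the evolved Green function leaves a function whose
derivative is `O(t^{-1/2})`. -/
lemma exists_greenTrace_add_log {lam : ℝ} (hlam : 0 < lam) :
    ∃ C : ℝ, 0 ≤ C ∧ ContinuousOn (fun t : ℝ => greenTrace lam t + (Real.log t : ℂ)) (Ioi 0) ∧
      ∀ s t : ℝ, 0 < s → s ≤ t →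
        ‖(greenTrace lam t + (Real.log t : ℂ)) - (greenTrace lam s + (Real.log s : ℂ))‖
          ≤ C * (Real.sqrt t - Real.sqrt s) := by
  obtain ⟨C, hC0, hC⟩ := exists_norm_greenTrace_le hlam
  have hd : ∀ t : ℝ, 0 < t → HasDerivAt (fun t : ℝ => greenTrace lam t + (Real.log t : ℂ))
      (Complex.I * lam * greenTrace lam t) t := by
    intro t ht
    have h1 := (hasDerivAt_greenTrace hlam ht).add (Real.hasDerivAt_log ht.ne').ofReal_comp
    convert! h1 using 1
    push_cast; ring
  have hcont : ContinuousOn (fun t : ℝ => greenTrace lam t + (Real.log t : ℂ)) (Ioi 0) :=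
    fun t ht => (hd t ht).continuousAt.continuousWithinAt
  refine ⟨2 * lam * C, by positivity, hcont, fun s t hs hst => ?_⟩
  refine image_norm_le_of_norm_deriv_right_le_deriv_boundary' (a := s) (b := t)
    (f := fun r : ℝ => (greenTrace lam r + (Real.log r : ℂ))
      - (greenTrace lam s + (Real.log s : ℂ)))
    (f' := fun r => Complex.I * lam * greenTrace lam r)
    (B := fun r => 2 * lam * C * (Real.sqrt r - Real.sqrt s))
    (B' := fun r => 2 * lam * C * (1 / (2 * Real.sqrt r)))
    ?_ ?_ (by simp) (by fun_prop) ?_ ?_ ⟨hst, le_rfl⟩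
  · exact (hcont.mono fun r hr => hs.trans_le hr.1).sub continuousOn_const
  · intro r hr
    exact ((hd r (hs.trans_le hr.1)).sub_const _).hasDerivWithinAt
  · intro r hr
    exact (((Real.hasDerivAt_sqrt (hs.trans_le hr.1).ne').sub_const _).const_mul _).hasDerivWithinAt
  · intro r hr
    have hr0 := hs.trans_le hr.1
    rw [norm_mul, norm_mul, Complex.norm_I, one_mul, Complex.norm_real,
      Real.norm_of_nonneg hlam.le]
    calc lam * ‖greenTrace lam r‖ ≤ lam * (C / Real.sqrt r) := by gcongr; exact hC r hr0
      _ = _ := by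
        have := (Real.sqrt_pos.2 hr0).ne'
        field_simp

/-- The source of the charge equation is a multiple of `-(log t + γ)` plus a function of bounded
variation near `t = 0`. -/
theorem exists_freeEvolution_decomposition {lam : ℝ} (hlam : 0 < lam) {ψ₀ : Plane → ℂ}
    (hψ₀ : ψ₀ ∈ schwartzData lam) :
    ∃ (q₀ : ℂ) (R : ℝ → ℂ) (G : ℝ → ℝ), ContinuousOn R (Ioi 0) ∧ Monotone G ∧
      (∀ s t, 0 < s → s ≤ t → ‖R t - R s‖ ≤ G t - G s) ∧
      ∀ t : ℝ, 0 < t → 4 * (Real.pi : ℂ) * freeEvolution t ψ₀ 0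
        = R t - q₀ * ((Real.log t + Real.eulerMascheroniConstant : ℝ) : ℂ) := by
  obtain ⟨φ, q₀, hψ⟩ := hψ₀
  obtain ⟨C₁, hC₁, h₁⟩ := exists_lipschitz_freeEvolution_schwartz φ
  obtain ⟨C₂, hC₂, hcont, h₂⟩ := exists_greenTrace_add_log hlam
  have hφc : ContinuousOn (fun t => freeEvolution t φ 0) (Ioi 0) := by
    refine LipschitzOnWith.continuousOn (K := ⟨C₁, hC₁⟩)
      (LipschitzOnWith.of_dist_le_mul fun a ha b hb => ?_)
    rw [dist_eq_norm, Real.dist_eq]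
    rcases le_total a b with hab | hab
    · rw [norm_sub_rev, abs_sub_comm, abs_of_nonneg (sub_nonneg.2 hab)]
      exact h₁ a b ha hab
    · rw [abs_of_nonneg (sub_nonneg.2 hab)]
      exact h₁ b a hb hab
  refine ⟨q₀, fun t => 4 * Real.pi * freeEvolution t φ 0
      + q₀ * (greenTrace lam t + (Real.log t : ℂ)) + q₀ * Real.eulerMascheroniConstant,
    fun t => 4 * Real.pi * C₁ * t + ‖q₀‖ * C₂ * Real.sqrt t, ?_, ?_, ?_, ?_⟩
  · exact ((continuousOn_const.mul hφc).add (continuousOn_const.mul hcont)).add continuousOn_const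
  · intro a b hab
    have := Real.sqrt_le_sqrt hab
    simp only
    gcongr
  · intro s t hs hst
    have e : (4 * Real.pi * freeEvolution t φ 0 + q₀ * (greenTrace lam t + (Real.log t : ℂ))
          + q₀ * Real.eulerMascheroniConstant)
        - (4 * Real.pi * freeEvolution s φ 0 + q₀ * (greenTrace lam s + (Real.log s : ℂ))
          + q₀ * Real.eulerMascheroniConstant)
        = ((4 * Real.pi : ℝ) : ℂ) * (freeEvolution t φ 0 - freeEvolution s φ 0)
          + q₀ * ((greenTrace lam t + (Real.log t : ℂ)) - (greenTrace lam s + (Real.log s : ℂ))) := by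
      push_cast; ring
    rw [e]
    refine (norm_add_le _ _).trans ?_
    rw [norm_mul, norm_mul, Complex.norm_real, Real.norm_of_nonneg (by positivity)]
    have u1 := mul_le_mul_of_nonneg_left (h₁ s t hs hst) (show 0 ≤ 4 * Real.pi by positivity)
    have u2 := mul_le_mul_of_nonneg_left (h₂ s t hs hst) (norm_nonneg q₀)
    linarith
  · intro t ht
    rw [freeEvolution_schwartzData hlam ht φ q₀ hψ]
    push_cast; ring

/-! ### The charge equation -/

/-- The local nonlinearity `z ↦ -4πβ |z|^{2σ} z + κ z` of the charge equation. -/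
noncomputable def chargeNonlinearity (σ β : ℝ) (z : ℂ) : ℂ :=
  -4 * (Real.pi : ℂ) * (β : ℂ) * ((‖z‖ ^ (2 * σ) : ℝ) : ℂ) * z + kappa * z

lemma nonlinearKernel_add (σ β t s : ℝ) (z : ℂ) :
    nonlinearKernel σ β t s z + kappa * (volterra (t - s) : ℂ) * z
      = (volterra (t - s) : ℂ) * chargeNonlinearity σ β z := by
  unfold nonlinearKernel chargeNonlinearity; ring

lemma continuous_chargeNonlinearity {σ : ℝ} (hσ : 1 / 2 ≤ σ) (β : ℝ) :
    Continuous (chargeNonlinearity σ β) := by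
  unfold chargeNonlinearity
  have : Continuous fun z : ℂ => ‖z‖ ^ (2 * σ) :=
    continuous_norm.rpow_const fun _ => Or.inr (by linarith)
  fun_prop

lemma chargeNonlinearity_zero (σ β : ℝ) : chargeNonlinearity σ β 0 = 0 := by
  simp [chargeNonlinearity]

lemma abs_rpow_sub_rpow_le {p B x y : ℝ} (hp : 1 ≤ p) (hx : x ∈ Icc 0 B) (hy : y ∈ Icc 0 B) :
    |x ^ p - y ^ p| ≤ p * B ^ (p - 1) * |x - y| := by
  refine (convex_Icc 0 B).norm_image_sub_le_of_norm_hasDerivWithin_le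
    (f := fun x : ℝ => x ^ p) (f' := fun x => p * x ^ (p - 1))
    (fun z _ => (Real.hasDerivAt_rpow_const (Or.inr hp)).hasDerivWithinAt) (fun z hz => ?_) hy hx
  rw [Real.norm_of_nonneg (mul_nonneg (by linarith) (Real.rpow_nonneg hz.1 _))]
  exact mul_le_mul_of_nonneg_left (Real.rpow_le_rpow hz.1 hz.2 (by linarith)) (by linarith)

lemma exists_lipschitz_chargeNonlinearity {σ : ℝ} (hσ : 1 / 2 ≤ σ) (β : ℝ) {B : ℝ} (hB : 0 ≤ B) :
    ∃ L : ℝ, 0 ≤ L ∧ ∀ a b : ℂ, ‖a‖ ≤ B → ‖b‖ ≤ B →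
      ‖chargeNonlinearity σ β a - chargeNonlinearity σ β b‖ ≤ L * ‖a - b‖ := by
  have hp : 1 ≤ 2 * σ := by linarith
  set M : ℝ := B ^ (2 * σ) + 2 * σ * B ^ (2 * σ - 1) * B with hM
  have hM0 : 0 ≤ M := by positivity
  refine ⟨4 * Real.pi * |β| * M + ‖kappa‖, by positivity, fun a b ha hb => ?_⟩
  have hpow : ‖((‖a‖ ^ (2 * σ) : ℝ) : ℂ) * a - ((‖b‖ ^ (2 * σ) : ℝ) : ℂ) * b‖ ≤ M * ‖a - b‖ := by
    have e : ((‖a‖ ^ (2 * σ) : ℝ) : ℂ) * a - ((‖b‖ ^ (2 * σ) : ℝ) : ℂ) * b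
        = ((‖a‖ ^ (2 * σ) : ℝ) : ℂ) * (a - b)
          + ((‖a‖ ^ (2 * σ) - ‖b‖ ^ (2 * σ) : ℝ) : ℂ) * b := by push_cast; ring
    rw [e]
    refine (norm_add_le _ _).trans ?_
    rw [norm_mul, norm_mul, Complex.norm_real, Complex.norm_real,
      Real.norm_of_nonneg (by positivity), Real.norm_eq_abs]
    have h1 := abs_rpow_sub_rpow_le hp ⟨norm_nonneg a, ha⟩ ⟨norm_nonneg b, hb⟩
    have h2 := abs_norm_sub_norm_le a b
    calc _ ≤ B ^ (2 * σ) * ‖a - b‖ + (2 * σ * B ^ (2 * σ - 1) * ‖a - b‖) * B := by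
          gcongr
          exact h1.trans (by gcongr)
      _ = _ := by rw [hM]; ring
  have e : chargeNonlinearity σ β a - chargeNonlinearity σ β b
      = ((-4 * Real.pi * β : ℝ) : ℂ) *
        (((‖a‖ ^ (2 * σ) : ℝ) : ℂ) * a - ((‖b‖ ^ (2 * σ) : ℝ) : ℂ) * b) + kappa * (a - b) := by
    unfold chargeNonlinearity; push_cast; ring
  rw [e]
  refine (norm_add_le _ _).trans ?_
  rw [norm_mul, norm_mul, Complex.norm_real, Real.norm_eq_abs, abs_mul, abs_mul, abs_neg,
    abs_of_pos Real.pi_pos, abs_of_pos (show (0 : ℝ) < 4 by norm_num), add_mul, mul_assoc _ M]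
  gcongr

/-- The charge equation in the form `q = q₀ + 𝓘 * (R - Φ(q))`, the logarithmic part of the source
having been integrated to the constant `q₀`. -/
lemma charge_eq_add_integral {σ β : ℝ} (hσ : 1 / 2 ≤ σ) {ψ₀ : Plane → ℂ} {S : EReal} {q R : ℝ → ℂ}
    (hq : IsChargeSolution σ β ψ₀ S q) {q₀ : ℂ} (hRc : ContinuousOn R (Ioi 0)) {t B B' : ℝ}
    (ht : 0 < t) (htS : (t : EReal) < S) (hRB : ∀ s ∈ Ioo 0 t, ‖R s‖ ≤ B')
    (hqB : ∀ s ∈ Ioo 0 t, ‖chargeNonlinearity σ β (q s)‖ ≤ B)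
    (hsource : ∀ s : ℝ, 0 < s → 4 * (Real.pi : ℂ) * freeEvolution s ψ₀ 0
        = R s - q₀ * ((Real.log s + Real.eulerMascheroniConstant : ℝ) : ℂ)) :
    q t = q₀ + ∫ s in Ioo 0 t, volterra (t - s) • (R s - chargeNonlinearity σ β (q s)) := by
  have hV : IntegrableOn (fun s => volterra (t - s)) (Ioo 0 t) := by
    simpa [powerKernel_one] using integrableOn_volterra_mul_powerKernel one_pos ht
  have hmul : ∀ (u : ℝ → ℂ) (M : ℝ), ContinuousOn u (Ioo 0 t) → (∀ s ∈ Ioo 0 t, ‖u s‖ ≤ M) →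
      IntegrableOn (fun s => volterra (t - s) • u s) (Ioo 0 t) := by
    intro u M hu hM
    refine hV.smul_bdd M (hu.aestronglyMeasurable measurableSet_Ioo) ?_
    filter_upwards [ae_restrict_mem measurableSet_Ioo] with s hs using hM s hs
  have hqc : ContinuousOn q (Ioo 0 t) := hq.continuousOn.mono fun s hs =>
    ⟨hs.1.le, lt_trans (by exact_mod_cast hs.2) htS⟩
  have hRi := hmul R B' (hRc.mono fun s hs => hs.1) hRB
  have hΦi := hmul (fun s => chargeNonlinearity σ β (q s)) B
    ((continuous_chargeNonlinearity hσ β).comp_continuousOn hqc) hqB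
  obtain ⟨hli, hl⟩ := integral_volterra_mul_log ht
  have heq := hq.equation t ht htS
  rw [forcing, intervalIntegral.integral_of_le ht.le, intervalIntegral.integral_of_le ht.le,
    integral_Ioc_eq_integral_Ioo, integral_Ioc_eq_integral_Ioo, ← integral_const_mul] at heq
  have e1 : ∫ s in Ioo 0 t, (nonlinearKernel σ β t s (q s)
      + kappa * (volterra (t - s) : ℂ) * q s)
      = ∫ s in Ioo 0 t, volterra (t - s) • chargeNonlinearity σ β (q s) := by
    congr 1; ext s; rw [nonlinearKernel_add, Complex.real_smul]
  have e2 : ∫ s in Ioo 0 t, 4 * (Real.pi : ℂ) * ((volterra (t - s) : ℂ) * freeEvolution s ψ₀ 0)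
      = ∫ s in Ioo 0 t, (volterra (t - s) • R s - q₀ * ((volterra (t - s)
        * (Real.log s + Real.eulerMascheroniConstant) : ℝ) : ℂ)) := by
    refine setIntegral_congr_fun measurableSet_Ioo fun s hs => ?_
    rw [mul_left_comm, hsource s hs.1, Complex.real_smul]
    push_cast; ring
  have hli' : IntegrableOn (fun s => q₀ * ((volterra (t - s)
      * (Real.log s + Real.eulerMascheroniConstant) : ℝ) : ℂ)) (Ioo 0 t) :=
    hli.ofReal.const_mul q₀
  rw [e1, e2, integral_sub hRi hli', integral_const_mul,
    integral_complex_ofReal, hl] at heq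
  simp only [smul_sub]
  rw [integral_sub hRi hΦi]
  push_cast at heq
  linear_combination heq

/-- Convolution on the line of functions supported in `(0, T)` is convolution on `(0, t)`. -/
lemma convolution_indicator {T t : ℝ} (ht : t ∈ Ioo 0 T) (k : ℝ → ℝ) {w w' : ℝ → ℂ}
    (h0 : ∀ s ∉ Ioo 0 T, w s = 0) (hw : ∀ s ∈ Ioo 0 T, w s = w' s) :
    ((Ioo 0 T).indicator k ⋆ w) t = ∫ s in Ioo 0 t, k (t - s) • w' s := by
  rw [convolution_lsmul_swap, ← integral_indicator measurableSet_Ioo]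
  congr 1; ext s
  by_cases hs : s ∈ Ioo 0 t
  · rw [indicator_of_mem hs, indicator_of_mem
      (show t - s ∈ Ioo 0 T from ⟨by linarith [hs.2], by linarith [hs.1, ht.2]⟩),
      hw s ⟨hs.1, hs.2.trans ht.2⟩]
  · rw [indicator_of_notMem hs]
    by_cases hs0 : 0 < s
    · have : t - s ∉ Ioo 0 T := fun h => hs ⟨hs0, by linarith [h.1]⟩
      rw [indicator_of_notMem this, zero_smul]
    · rw [h0 s fun h => hs0 h.1, smul_zero]

end PointNLS

/-- `W^{1,1}`-regularity of the charge: up to every time before the maximal existence time. -/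
theorem proposition3p3 (σ β lam : ℝ) (hσ : 1 / 2 ≤ σ) (hβ : 0 < β) (hlam : 0 < lam)
    (ψ₀ : PointNLS.Plane → ℂ) (hψ₀ : ψ₀ ∈ PointNLS.schwartzData lam)
    (Tstar : EReal) (q : ℝ → ℂ)
    (hq : PointNLS.IsMaximalChargeSolution σ β ψ₀ Tstar q)
    (T : ℝ) (hT : 0 < T) (hTstar : (T : EReal) < Tstar) :
    PointNLS.MemW11 0 T q := by
  obtain ⟨q₀, R, G, hRc, hG, hRG, hsource⟩ :=
    PointNLS.exists_freeEvolution_decomposition hlam hψ₀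
  set Φ := PointNLS.chargeNonlinearity σ β with hΦdef
  have hsol := hq.isSolution
  have hqc : ContinuousOn q (Icc 0 T) := hsol.continuousOn.mono fun s hs =>
    ⟨hs.1, lt_of_le_of_lt (by exact_mod_cast hs.2) hTstar⟩
  obtain ⟨B, hB⟩ := isCompact_Icc.exists_bound_of_continuousOn hqc
  have hB0 : 0 ≤ B := (norm_nonneg _).trans (hB 0 ⟨le_rfl, hT.le⟩)
  obtain ⟨L, hL, hLip⟩ := PointNLS.exists_lipschitz_chargeNonlinearity hσ β hB0
  have hRB : ∀ s ∈ Ioo 0 T, ‖R s‖ ≤ ‖R T‖ + (G T - G 0) := by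
    intro s hs
    have h1 := hRG s T hs.1 hs.2.le
    have h2 := hG hs.1.le
    have h3 := norm_sub_norm_le (R s) (R T)
    rw [norm_sub_rev] at h3
    linarith
  have hΦB : ∀ s ∈ Ioo 0 T, ‖Φ (q s)‖ ≤ L * B := by
    intro s hs
    have hqs := hB s (Ioo_subset_Icc_self hs)
    have := hLip (q s) 0 hqs (by simpa using hB0)
    rw [PointNLS.chargeNonlinearity_zero, sub_zero, sub_zero] at this
    exact this.trans (by gcongr)
  set k := (Ioo 0 T).indicator PointNLS.volterra with hk
  set p := (Ioo 0 T).indicator q with hp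
  set r := (Ioo 0 T).indicator R with hr
  have hki : Integrable k :=
    (PointNLS.integrableOn_volterra hT).integrable_indicator measurableSet_Ioo
  have hk0 : ∀ t ≤ 0, k t = 0 := fun t ht => indicator_of_notMem (fun h => ht.not_gt h.1) _
  have hp0 : ∀ t ∉ Ioo 0 T, p t = 0 := fun t ht => indicator_of_notMem ht _
  have hr0 : ∀ t ∉ Ioo 0 T, r t = 0 := fun t ht => indicator_of_notMem ht _
  have hpm : AEStronglyMeasurable p := (aestronglyMeasurable_indicator_iff measurableSet_Ioo).2
    ((hqc.mono Ioo_subset_Icc_self).aestronglyMeasurable measurableSet_Ioo)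
  have hrm : AEStronglyMeasurable r := (aestronglyMeasurable_indicator_iff measurableSet_Ioo).2
    ((hRc.mono fun s hs => hs.1).aestronglyMeasurable measurableSet_Ioo)
  have hpB : ∀ t, ‖p t‖ ≤ B := by
    intro t
    by_cases ht : t ∈ Ioo 0 T
    · rw [hp, indicator_of_mem ht]; exact hB t (Ioo_subset_Icc_self ht)
    · rw [hp0 t ht, norm_zero]; exact hB0
  have hrB : ∀ t, ‖r t‖ ≤ ‖R T‖ + (G T - G 0) := by
    intro t
    by_cases ht : t ∈ Ioo 0 T
    · rw [hr, indicator_of_mem ht]; exact hRB t ht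
    · rw [hr0 t ht, norm_zero]
      have := hG hT.le
      have := norm_nonneg (R T)
      linarith
  have hΦc : Continuous Φ := PointNLS.continuous_chargeNonlinearity hσ β
  have hw0 : ∀ s ∉ Ioo 0 T, r s - Φ (p s) = 0 := by
    intro s hs
    rw [hr0 s hs, hp0 s hs, hΦdef, PointNLS.chargeNonlinearity_zero, sub_zero]
  have hfix : ∀ t ∈ Ioo 0 T, q t = q₀ +
      (convolution k (fun s => r s - Φ (p s)) (ContinuousLinearMap.lsmul ℝ ℝ)) t := by
    intro t ht
    rw [hk, PointNLS.convolution_indicator ht PointNLS.volterra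
      (w' := fun s => R s - Φ (q s)) hw0 fun s hs => by
        rw [hr, hp, indicator_of_mem hs, indicator_of_mem hs]]
    have hsub : ∀ s ∈ Ioo 0 t, s ∈ Ioo 0 T := fun s hs => ⟨hs.1, hs.2.trans ht.2⟩
    exact PointNLS.charge_eq_add_integral hσ hsol hRc ht.1
      (lt_trans (by exact_mod_cast ht.2) hTstar) (fun s hs => hRB s (hsub s hs))
      (fun s hs => hΦB s (hsub s hs)) hsource
  have hlip := PointNLS.translationLipschitz_of_volterra hT hki hk0 hpm hrm hpB hrB hp0 hr0 hΦc
    (PointNLS.chargeNonlinearity_zero σ β) hL hLip (c := q₀)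
    (fun t ht => by rw [hp, indicator_of_mem ht]; exact hfix t ht)
    (PointNLS.translationLipschitz_indicator hT hG (fun s t hs hst _ => hRG s t hs hst) hRB)
  have hwi : Integrable fun s => r s - Φ (p s) := by
    refine PointNLS.integrable_of_bounded_support (T := T)
      (hrm.sub (hΦc.comp_aestronglyMeasurable hpm)) (B := ‖R T‖ + (G T - G 0) + L * B)
      (fun s => ?_) hw0
    refine (norm_sub_le _ _).trans (add_le_add (hrB s) ?_)
    by_cases hs : s ∈ Ioo 0 T
    · rw [hp, indicator_of_mem hs]; exact hΦB s hs
    · rw [hp0 s hs, hΦdef, PointNLS.chargeNonlinearity_zero, norm_zero]; positivity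
  obtain ⟨v, hvi, hv⟩ := PointNLS.exists_weakDeriv_convolution hki hwi hlip
  refine ⟨hqc.integrableOn_Icc.mono_set Ioo_subset_Icc_self, v, hvi.integrableOn,
    fun η hη hηc hηs => ?_⟩
  have hη1 : ContDiff ℝ 1 η := hη.of_le (by exact_mod_cast le_top)
  have hη0 : ∀ t ∉ Ioo 0 T, η t = 0 := fun t ht =>
    image_eq_zero_of_notMem_tsupport fun h => ht (hηs h)
  have hdη0 : ∀ t ∉ Ioo 0 T, deriv η t = 0 := fun t ht =>
    image_eq_zero_of_notMem_tsupport fun h => ht (hηs (tsupport_deriv_subset h))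
  set U := convolution k (fun s => r s - Φ (p s)) (ContinuousLinearMap.lsmul ℝ ℝ) with hU
  have hUi : Integrable U := hki.integrable_convolution _ hwi
  have hdηc : Continuous (deriv η) := hη1.continuous_deriv le_rfl
  have hdηi : Integrable (deriv η) := hdηc.integrable_of_hasCompactSupport hηc.deriv
  have hint0 : ∫ t, deriv η t = 0 :=
    integral_eq_zero_of_hasDerivAt_of_integrable
      (fun t => (hη1.differentiable one_ne_zero t).hasDerivAt) hdηi
      (hη1.continuous.integrable_of_hasCompactSupport hηc)
  obtain ⟨M, hM⟩ := hηc.deriv.exists_bound_of_continuous hdηc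
  have hdUi : Integrable fun t => deriv η t • U t :=
    hUi.bdd_smul M hdηc.aestronglyMeasurable (Eventually.of_forall hM)
  calc ∫ t in Ioo 0 T, ((deriv η t : ℝ) : ℂ) * q t
      = ∫ t in Ioo 0 T, (deriv η t • q₀ + deriv η t • U t) := by
        refine setIntegral_congr_fun measurableSet_Ioo fun t ht => ?_
        rw [hfix t ht, mul_add, Complex.real_smul, Complex.real_smul]
    _ = ∫ t, (deriv η t • q₀ + deriv η t • U t) :=
        setIntegral_eq_integral_of_forall_compl_eq_zero fun t ht => by simp [hdη0 t ht]
    _ = (∫ t, deriv η t) • q₀ + ∫ t, deriv η t • U t := by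
        rw [integral_add (hdηi.smul_const q₀) hdUi, integral_smul_const]
    _ = -∫ t, η t • v t := by rw [hint0, zero_smul, zero_add, hv η hη hηc]
    _ = -∫ t in Ioo 0 T, ((η t : ℝ) : ℂ) * v t := by
        rw [setIntegral_eq_integral_of_forall_compl_eq_zero fun t ht => by simp [hη0 t ht]]
        simp only [Complex.real_smul]
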